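/- For a measurable function $u:\mathbb{R}^3\to\mathbb{C}$ and $1\le r<\infty$ let $M_r u(x)=\sup_{\rho>0}\left(\frac1{|B(x,\rho)|}\int_{B(x,\rho)}|u(y)|^r\,dy\right)^{1/r}$, where $B(x,\rho)$ is the ball of radius $\rho$ centred at $x$. For $f\in L^p(\mathbb{R}^3)$, $1\le p\le 2$, let $\widehat f$ denote its Fourier transform, normalized by $\widehat f(\xi)=\int_{\mathbb{R}^3}e^{-2\pi i x\cdot\xi}f(x)\,dx$ for integrable $f$ and extended to $L^1+L^2$ in the usual way. Let $L^2(\mathbb{S}^2)$ be taken with respect to the surface measure of the unit sphere $\mathbb{S}^2\subset\mathbb{R}^3$. (i) For all $1\le r<2$ and $1\le p\le\frac43$ there is a constant $C_{p,r}<\infty$ such that $$\|M_r(\widehat f)\|_{L^2(\mathbb{S}^2)}\le C_{p,r}\|f\|_{L^p(\mathbb{R}^3)}\qquad\text{for all } f\in L^p(\mathbb{R}^3).$$ (ii) For all $1\le p<\frac43$ there is a constant $C_p<\infty$ such that $$\|M_2(\widehat f)\|_{L^2(\mathbb{S}^2)}\le C_p\|f\|_{L^p(\mathbb{R}^3)}\qquad\text{for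 all } f\in L^p(\mathbb{R}^3).$$ -/

import Mathlib

open MeasureTheory Set
open scoped ENNReal NNReal FourierTransform

noncomputable section

/-- Three-dimensional Euclidean space. -/
abbrev R3 : Type := EuclideanSpace ℝ (Fin 3)

/-- The unit sphere in three-dimensional Euclidean space. -/
abbrev S2 : Type := Metric.sphere (0 : R3) 1

/-- The surface measure on the unit sphere, the one that appears in polar coordinates. -/
def surfaceMeasure : Measure S2 := (volume : Measure R3).toSphere

/-- The part of `f` where `|f| > 1`. It is integrable if `f` is in `L^p` with `p ≥ 1`. -/
def largePart (f : R3 → ℂ) : R3 → ℂ := {x | 1 < ‖f x‖ₑ}.indicator f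

/-- The part of `f` where `|f| ≤ 1`. It is square integrable if `f` is in `L^p` with `p ≤ 2`. -/
def smallPart (f : R3 → ℂ) : R3 → ℂ := {x | ‖f x‖ₑ ≤ 1}.indicator f

theorem largePart_add_smallPart (f : R3 → ℂ) : largePart f + smallPart f = f := by
  funext x
  by_cases h : 1 < ‖f x‖ₑ
  · simp [largePart, smallPart, indicator, h, not_le.mpr h]
  · simp [largePart, smallPart, indicator, h, not_lt.mp h]

theorem memLp_largePart {p : ℝ≥0∞} (hp : 1 ≤ p) (hp' : p ≤ 2) {f : R3 → ℂ}
    (hf : MemLp f p volume) : MemLp (largePart f) 1 volume := by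
  have hptop : p ≠ ∞ := ne_top_of_le_ne_top (by simp) hp'
  have hp0 : p ≠ 0 := (zero_lt_one.trans_le hp).ne'
  have hs : NullMeasurableSet {x | 1 < ‖f x‖ₑ} volume :=
    nullMeasurableSet_lt aemeasurable_const hf.aestronglyMeasurable.enorm
  refine ⟨hf.aestronglyMeasurable.indicator₀ hs, ?_⟩
  rw [eLpNorm_one_eq_lintegral_enorm]
  refine lt_of_le_of_lt (lintegral_mono fun x => ?_)
    ((eLpNorm_lt_top_iff_lintegral_rpow_enorm_lt_top hp0 hptop).1 hf.2)
  by_cases h : 1 < ‖f x‖ₑ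
  · have h1 : (1 : ℝ) ≤ p.toReal := by
      simpa using (ENNReal.toReal_le_toReal (by simp) hptop).2 hp
    simpa [largePart, indicator, h] using ENNReal.rpow_le_rpow_of_exponent_le h.le h1
  · simp [largePart, indicator, h]

theorem memLp_smallPart {p : ℝ≥0∞} (hp : 1 ≤ p) (hp' : p ≤ 2) {f : R3 → ℂ}
    (hf : MemLp f p volume) : MemLp (smallPart f) 2 volume := by
  have hptop : p ≠ ∞ := ne_top_of_le_ne_top (by simp) hp'
  have hp0 : p ≠ 0 := (zero_lt_one.trans_le hp).ne'
  have hs : NullMeasurableSet {x | ‖f x‖ₑ ≤ 1} volume :=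
    nullMeasurableSet_le hf.aestronglyMeasurable.enorm aemeasurable_const
  refine ⟨hf.aestronglyMeasurable.indicator₀ hs, ?_⟩
  rw [eLpNorm_lt_top_iff_lintegral_rpow_enorm_lt_top (by simp) (by simp)]
  refine lt_of_le_of_lt (lintegral_mono fun x => ?_)
    ((eLpNorm_lt_top_iff_lintegral_rpow_enorm_lt_top hp0 hptop).1 hf.2)
  by_cases h : ‖f x‖ₑ ≤ 1
  · have h2 : p.toReal ≤ (2 : ℝ≥0∞).toReal :=
      (ENNReal.toReal_le_toReal hptop (by simp)).2 hp'
    simpa [smallPart, indicator, h] using ENNReal.rpow_le_rpow_of_exponent_ge h h2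
  · simp [smallPart, indicator, h]

open Classical in
/-- The Fourier transform, normalized with the kernel `exp (-2πi x·ξ)`, of a function
`f` in `L^p`, `1 ≤ p ≤ 2`. As usual on `L^1 + L^2`, it is the sum of the Fourier integral of an
integrable part of `f` and of the Plancherel transform of a square integrable part of `f`; up to
a null set it does not depend on how `f` is split. The split used here is at height one, and for
such `f` the first branch applies by `memLp_smallPart`. -/
def fourierL1L2 (f : R3 → ℂ) : R3 → ℂ :=
  if h : MemLp (smallPart f) 2 volume then
    fun ξ => 𝓕 (largePart f) ξ + (𝓕 (h.toLp (smallPart f)) : Lp ℂ 2 (volume : Measure R3)) ξ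
  else 0

/-- The centred Hardy–Littlewood maximal function of a nonnegative function. -/
def hlMaximal (u : R3 → ℝ≥0∞) (x : R3) : ℝ≥0∞ :=
  ⨆ (ρ : ℝ) (_ : 0 < ρ), ⨍⁻ y in Metric.ball x ρ, u y ∂volume

/-- The `r`-average maximal function `M_r h = (M (|h|^r))^(1/r)`. -/
def rMaximal (r : ℝ) (h : R3 → ℂ) (x : R3) : ℝ≥0∞ :=
  (hlMaximal (fun y => ‖h y‖ₑ ^ r) x) ^ (1 / r)

end

noncomputable section

/-! ### The Hardy–Littlewood maximal function on three-dimensional space -/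

/-! The core is the duality proof of the `L^{4/3}` restriction estimate, run with averages over
balls in place of point values. Let u be the Fourier transform of an integrable f, let μ be a finite
measure with μ * μ ≤ D dx, choose a measurable radius ρ(ω), and let A(ω) be the `L^r` average of |u|
over the ball B(ω, ρ(ω)). A density J_ω on that ball (`dualDensity`) satisfies ∫ |u| J_ω = A(ω)² and
has mass at most A(ω). Put G = ∫ J_ω dμ(ω), S = ∫ A² dμ = ∫ |u| G and X = ‖G * G‖₂². Moving the
Fourier transform from f to G times a phase, Hölder with 4/3 and 4, and Plancherel applied to a
convolution square give S ≤ ‖f‖_{4/3} X^{1/4} (`lintegral_enorm_fourier_mul_le`).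

In the other direction, X is the double μ-integral of the pairings of H = G * G with J_ω * J_ω'.
Sums x + y of points of the two balls lie in a ball around ω + ω' of twice the larger radius, so
each pairing is at most 8 A(ω) A(ω') M_r H(ω + ω'). Cauchy–Schwarz, the bound on μ * μ and the
maximal theorem on `L^{2/r}`, which is where r < 2 enters, give X ≤ R S X^{1/2}
(`lintegral_lconvolution_dualDensity_sq_le`). The two inequalities together give S ≤ R ‖f‖_{4/3}²,
uniformly in ρ.

Surface measure itself is not admissible, since its self-convolution blows up at the origin. The
sphere is therefore covered by six caps, on each of which sums of two points stay away from the
origin, and each cap is thickened to a normalised shell. The hypothesis then becomes a volume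
estimate uniform in the thickness (`selfConvolutionBound_capMeasure`), and lower semicontinuity of
M_r u leads back to the sphere (`setLIntegral_sphereCap_le`).

Smaller p follow by cutting f at heights and using the trivial `L^1` bound. For r = 2 the inequality
M_2 u ≤ (M_{2θ} u)^θ ‖u‖_∞^{1-θ} yields a bound by a product of the `L^{4/3}` and `L^1` norms, under
which dyadic layers of f sum geometrically when p < 4/3 (`exists_sphereNorm_two_fourier_le_of_lt`).
Finally, the Fourier transform on `L^p` is an almost everywhere limit of Fourier integrals of
truncations, and Fatou's lemma carries the estimates over (`sphereNorm_fourierL1L2_le`). -/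

theorem volume_ball_pos (x : R3) {ρ : ℝ} (hρ : 0 < ρ) : 0 < volume (Metric.ball x ρ) :=
  Metric.measure_ball_pos _ _ hρ

theorem volume_ball_two_mul (x y : R3) {ρ : ℝ} :
    volume (Metric.ball x (2 * ρ)) = 8 * volume (Metric.ball y ρ) := by
  rw [EuclideanSpace.volume_ball_fin_three, EuclideanSpace.volume_ball_fin_three,
    ENNReal.ofReal_mul (by norm_num), mul_pow]
  norm_num [mul_assoc]

theorem setLAverage_le_hlMaximal (u : R3 → ℝ≥0∞) (x : R3) {ρ : ℝ} (hρ : 0 < ρ) :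
    ⨍⁻ y in Metric.ball x ρ, u y ∂volume ≤ hlMaximal u x :=
  le_iSup₂ (f := fun (ρ : ℝ) (_ : 0 < ρ) => ⨍⁻ y in Metric.ball x ρ, u y ∂volume) ρ hρ

/-- Monotone convergence along smaller concentric balls. The room gained in the radius absorbs a
small move of the centre, which gives lower semicontinuity, or a change to a rational radius. -/
theorem exists_radius_lt_setLIntegral_ball (u : R3 → ℝ≥0∞) (x : R3) {ρ : ℝ} {c : ℝ≥0∞}
    (h : c < ∫⁻ y in Metric.ball x ρ, u y) :
    ∃ s < ρ, c < ∫⁻ y in Metric.ball x s, u y := by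
  have hU : Metric.ball x ρ = ⋃ n : ℕ, Metric.ball x (ρ - 1 / ((n : ℝ) + 1)) := by
    ext y
    simp only [Metric.mem_ball, mem_iUnion]
    constructor
    · intro hy
      obtain ⟨n, hn⟩ := exists_nat_one_div_lt (sub_pos.2 hy)
      exact ⟨n, by linarith⟩
    · rintro ⟨n, hn⟩
      have : (0 : ℝ) < 1 / ((n : ℝ) + 1) := by positivity
      linarith
  have hd : Directed (· ⊆ ·) fun n : ℕ => Metric.ball x (ρ - 1 / ((n : ℝ) + 1)) := by
    refine Monotone.directed_le fun m n hmn => Metric.ball_subset_ball ?_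
    have := one_div_le_one_div_of_le (α := ℝ) (a := m + 1) (b := n + 1) (by positivity)
      (by gcongr)
    linarith
  rw [hU, setLIntegral_iUnion_of_directed _ hd] at h
  obtain ⟨n, hn⟩ := lt_iSup_iff.1 h
  have : (0 : ℝ) < 1 / ((n : ℝ) + 1) := by positivity
  exact ⟨_, by linarith, hn⟩

theorem lowerSemicontinuous_setLIntegral_ball (u : R3 → ℝ≥0∞) (ρ : ℝ) :
    LowerSemicontinuous fun x => ∫⁻ y in Metric.ball x ρ, u y := by
  intro x c h
  obtain ⟨s, hs, hc⟩ := exists_radius_lt_setLIntegral_ball u x h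
  filter_upwards [Metric.ball_mem_nhds x (sub_pos.2 hs)] with z hz
  refine hc.trans_le (lintegral_mono_set (Metric.ball_subset_ball' ?_))
  rw [Metric.mem_ball, dist_comm] at hz
  linarith

theorem lt_setLAverage_ball_iff (u : R3 → ℝ≥0∞) (x : R3) {ρ : ℝ} (hρ : 0 < ρ) (c : ℝ≥0∞) :
    c < ⨍⁻ y in Metric.ball x ρ, u y ∂volume ↔
      c * volume (Metric.ball (0 : R3) ρ) < ∫⁻ y in Metric.ball x ρ, u y := by
  rw [setLAverage_eq, Measure.addHaar_ball_center, ENNReal.lt_div_iff_mul_lt]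
  · exact Or.inl (volume_ball_pos _ hρ).ne'
  · exact Or.inl measure_ball_lt_top.ne

theorem lowerSemicontinuous_setLAverage_ball (u : R3 → ℝ≥0∞) {ρ : ℝ} (hρ : 0 < ρ) :
    LowerSemicontinuous fun x => ⨍⁻ y in Metric.ball x ρ, u y ∂volume := by
  intro x c h
  filter_upwards [lowerSemicontinuous_setLIntegral_ball u ρ x _
    ((lt_setLAverage_ball_iff u x hρ c).1 h)] with z hz
  exact (lt_setLAverage_ball_iff u z hρ c).2 hz

theorem lowerSemicontinuous_hlMaximal (u : R3 → ℝ≥0∞) : LowerSemicontinuous (hlMaximal u) :=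
  lowerSemicontinuous_iSup fun _ => lowerSemicontinuous_iSup fun hρ =>
    lowerSemicontinuous_setLAverage_ball u hρ

theorem measurable_hlMaximal (u : R3 → ℝ≥0∞) : Measurable (hlMaximal u) :=
  (lowerSemicontinuous_hlMaximal u).measurable

/-- The maximal function is already attained as a supremum over positive rational radii. -/
theorem hlMaximal_eq_iSup_rat (u : R3 → ℝ≥0∞) (x : R3) :
    hlMaximal u x = ⨆ q : {q : ℚ // 0 < q}, ⨍⁻ y in Metric.ball x (q : ℝ), u y ∂volume := by
  refine le_antisymm (iSup₂_le fun ρ hρ => le_of_forall_lt fun c hc => ?_)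
    (iSup_le fun q => setLAverage_le_hlMaximal u x (by exact_mod_cast q.2))
  rw [lt_setLAverage_ball_iff u x hρ] at hc
  obtain ⟨s, hs, hc'⟩ := exists_radius_lt_setLIntegral_ball u x hc
  obtain ⟨q, hq1, hq2⟩ := exists_rat_btwn (max_lt hs hρ)
  have hq : (0 : ℝ) < q := (le_max_right _ _).trans_lt hq1
  have hsq : s ≤ q := ((le_max_left _ _).trans_lt hq1).le
  refine lt_iSup_iff.2 ⟨⟨q, by exact_mod_cast hq⟩, ?_⟩
  rw [lt_setLAverage_ball_iff u x hq]
  calc _ ≤ c * volume (Metric.ball (0 : R3) ρ) := by gcongr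
    _ < _ := hc'
    _ ≤ _ := lintegral_mono_set (Metric.ball_subset_ball hsq)

theorem hlMaximal_mono {u v : R3 → ℝ≥0∞} (h : ∀ y, u y ≤ v y) (x : R3) :
    hlMaximal u x ≤ hlMaximal v x := by
  refine iSup₂_mono fun ρ _ => ?_
  rw [setLAverage_eq, setLAverage_eq]
  gcongr
  exact h _

theorem hlMaximal_add_const_le (u : R3 → ℝ≥0∞) (c : ℝ≥0∞) (x : R3) :
    hlMaximal (fun y => u y + c) x ≤ hlMaximal u x + c := by
  refine iSup₂_le fun ρ hρ => ?_
  rw [setLAverage_eq, lintegral_add_right _ measurable_const, ENNReal.add_div,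
    setLIntegral_const, ENNReal.mul_div_cancel_right (volume_ball_pos _ hρ).ne'
      measure_ball_lt_top.ne, ← setLAverage_eq]
  gcongr
  exact setLAverage_le_hlMaximal u x hρ

theorem hlMaximal_le_const {u : R3 → ℝ≥0∞} {c : ℝ≥0∞} (h : ∀ y, u y ≤ c) (x : R3) :
    hlMaximal u x ≤ c := by
  refine (hlMaximal_mono (v := fun _ => 0 + c) (by simpa using h) x).trans
    ((hlMaximal_add_const_le (fun _ => 0) c x).trans ?_)
  simp [hlMaximal]

/-- The weak type `(1,1)` inequality. -/
theorem mul_volume_lt_hlMaximal_le (u : R3 → ℝ≥0∞) {t : ℝ≥0∞} (ht : t ≠ 0) (ht' : t ≠ ∞) :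
    t * volume {x | t < hlMaximal u x} ≤ 64 * ∫⁻ y, u y := by
  by_cases hI : ∫⁻ y, u y = ∞
  · simp [hI]
  let T : Set (R3 × ℝ) :=
    {a | 0 < a.2 ∧ t < ⨍⁻ y in Metric.ball a.1 a.2, u y ∂volume}
  have hT : ∀ a ∈ T, t * volume (Metric.ball a.1 a.2) ≤ ∫⁻ y in Metric.ball a.1 a.2, u y := by
    intro a ha
    rw [Measure.addHaar_ball_center]
    exact ((lt_setLAverage_ball_iff u a.1 ha.1 t).1 ha.2).le
  obtain ⟨R, hR⟩ : ∃ R : ℝ, ∀ a ∈ T, a.2 ≤ R := by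
    set v := volume (Metric.ball (0 : R3) 1)
    have hv : v ≠ 0 := (volume_ball_pos _ one_pos).ne'
    have hv' : v ≠ ∞ := measure_ball_lt_top.ne
    -- The Vitali covering needs bounded radii. A radius a > 1 satisfies a ≤ a³, and t v a³ is at
    -- most the integral of `u`.
    refine ⟨max 1 ((∫⁻ y, u y) / (t * v)).toReal, fun a ha => ?_⟩
    by_cases h1 : a.2 ≤ 1
    · exact h1.trans (le_max_left _ _)
    refine le_max_of_le_right ?_
    rw [← ENNReal.ofReal_le_iff_le_toReal
      (ENNReal.div_ne_top hI (mul_ne_zero ht hv)),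
      ENNReal.le_div_iff_mul_le (Or.inl (mul_ne_zero ht hv)) (Or.inl (ENNReal.mul_ne_top ht' hv'))]
    refine le_trans ?_ ((hT a ha).trans (setLIntegral_le_lintegral _ _))
    rw [Measure.addHaar_ball _ _ ha.1.le, finrank_euclideanSpace_fin, mul_left_comm]
    gcongr
    push Not at h1
    nlinarith [pow_pos ha.1 2]
  -- Any enlargement factor above 3 would do; the factor 4 produces the constant 64 = 4³.
  obtain ⟨s, hsT, hdisj, hcov⟩ := Vitali.exists_disjoint_subfamily_covering_enlargement_closedBall
    T Prod.fst Prod.snd R hR 4 (by norm_num)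
  have hcount : s.Countable := hdisj.countable_of_nonempty_interior fun a ha =>
    ⟨a.1, Metric.ball_subset_interior_closedBall (Metric.mem_ball_self (hsT ha).1)⟩
  have hsub : {x | t < hlMaximal u x} ⊆ ⋃ b ∈ s, Metric.closedBall b.1 (4 * b.2) := by
    intro x hx
    obtain ⟨ρ, hx⟩ := lt_iSup_iff.1 (show t < hlMaximal u x from hx)
    obtain ⟨hρ, hx⟩ := lt_iSup_iff.1 hx
    obtain ⟨b, hb, hsb⟩ := hcov (x, ρ) ⟨hρ, hx⟩
    exact mem_biUnion hb (hsb (Metric.mem_closedBall_self hρ.le))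
  have hdisj' : s.PairwiseDisjoint fun a => Metric.ball a.1 a.2 :=
    hdisj.mono fun _ => Metric.ball_subset_closedBall
  calc t * volume {x | t < hlMaximal u x}
      ≤ t * ∑' b : s, volume (Metric.closedBall b.1.1 (4 * b.1.2)) := by
        gcongr
        exact (measure_mono hsub).trans (measure_biUnion_le _ hcount _)
    _ = ∑' b : s, 64 * (t * volume (Metric.ball b.1.1 b.1.2)) := by
        rw [← ENNReal.tsum_mul_left]
        congr! 2 with b
        have hb := (hsT b.2).1
        rw [Measure.addHaar_closedBall _ _ (by positivity), Measure.addHaar_ball _ _ hb.le,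
          finrank_euclideanSpace_fin, mul_pow, ENNReal.ofReal_mul (by norm_num)]
        norm_num
        ring
    _ ≤ ∑' b : s, 64 * ∫⁻ y in Metric.ball b.1.1 b.1.2, u y :=
        ENNReal.tsum_le_tsum fun b => by gcongr; exact hT _ (hsT b.2)
    _ = 64 * ∫⁻ y in ⋃ b ∈ s, Metric.ball b.1 b.2, u y := by
        rw [ENNReal.tsum_mul_left, lintegral_biUnion hcount
          (fun _ _ => measurableSet_ball) hdisj']
    _ ≤ _ := by gcongr; exact Measure.restrict_le_self

/-- Where `u` is at most `t / 2` it adds at most `t / 2` to the maximal function. The remaining part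
must exceed `t / 2`, and the weak type bound at that height costs 128 = 2 · 64. -/
theorem mul_volume_lt_hlMaximal_le_setLIntegral {u : R3 → ℝ≥0∞} (hu : Measurable u)
    {t : ℝ} (ht : 0 < t) :
    ENNReal.ofReal t * volume {x | ENNReal.ofReal t < hlMaximal u x} ≤
      128 * ∫⁻ y in {y | ENNReal.ofReal t < 2 * u y}, u y := by
  have hS : MeasurableSet {y | ENNReal.ofReal t < 2 * u y} :=
    measurableSet_lt measurable_const (hu.const_mul 2)
  have hhalf : ENNReal.ofReal t = ENNReal.ofReal (t / 2) + ENNReal.ofReal (t / 2) := by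
    rw [← ENNReal.ofReal_add (by positivity) (by positivity), add_halves]
  have hle : ∀ y, u y ≤ {y | ENNReal.ofReal t < 2 * u y}.indicator u y +
      ENNReal.ofReal (t / 2) := by
    intro y
    by_cases hy : ENNReal.ofReal t < 2 * u y
    · rw [indicator_of_mem (by exact hy)]; exact le_self_add
    · rw [indicator_of_notMem (by exact hy), zero_add]
      rw [not_lt, hhalf, ← two_mul] at hy
      exact (ENNReal.mul_le_mul_iff_right (by simp) (by simp)).1 hy
  have hsub : {x | ENNReal.ofReal t < hlMaximal u x} ⊆
      {x | ENNReal.ofReal (t / 2) <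
        hlMaximal ({y | ENNReal.ofReal t < 2 * u y}.indicator u) x} := by
    intro x hx
    have := (show _ < _ from hx).trans_le
      ((hlMaximal_mono hle x).trans (hlMaximal_add_const_le _ _ x))
    nth_rw 1 [hhalf] at this
    exact lt_of_add_lt_add_right this
  calc _ ≤ 2 * (ENNReal.ofReal (t / 2) * volume {x | ENNReal.ofReal (t / 2) <
        hlMaximal ({y | ENNReal.ofReal t < 2 * u y}.indicator u) x}) := by
        rw [← mul_assoc]
        nth_rw 1 [hhalf]
        rw [← two_mul]
        gcongr
    _ ≤ 2 * (64 * ∫⁻ y, {y | ENNReal.ofReal t < 2 * u y}.indicator u y) := by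
        gcongr 2 * ?_
        exact mul_volume_lt_hlMaximal_le _ (by simpa using by positivity) (by simp)
    _ = _ := by rw [lintegral_indicator hS, ← mul_assoc]; norm_num

theorem lintegral_Ioi_indicator_rpow {a : ℝ≥0∞} (ha : a ≠ ∞) {q : ℝ} (hq : 0 < q) :
    a ^ q = ENNReal.ofReal q * ∫⁻ t in Ioi (0 : ℝ),
      {t : ℝ | ENNReal.ofReal t < a}.indicator (fun t => ENNReal.ofReal (t ^ (q - 1))) t := by
  -- The layer cake formula for a constant function on a one-point space.
  have h := lintegral_rpow_eq_lintegral_meas_lt_mul (Measure.dirac ())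
    (f := fun _ => a.toReal) (by filter_upwards with x using by simp) (by fun_prop) hq
  simp only [lintegral_dirac] at h
  rw [← ENNReal.ofReal_rpow_of_nonneg ENNReal.toReal_nonneg hq.le, ENNReal.ofReal_toReal ha] at h
  rw [h]
  congr 1
  refine setLIntegral_congr_fun measurableSet_Ioi fun t ht => ?_
  have : ENNReal.ofReal t < a ↔ t < a.toReal := ENNReal.ofReal_lt_iff_lt_toReal (le_of_lt ht) ha
  by_cases h : t < a.toReal
  · simp [indicator, this, h]
  · simp [indicator, this, h]

theorem rpow_le_lintegral_Ioi_indicator (a : ℝ≥0∞) {q : ℝ} (hq : 0 < q) :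
    a ^ q ≤ ENNReal.ofReal q * ∫⁻ t in Ioi (0 : ℝ),
      {t : ℝ | ENNReal.ofReal t < a}.indicator (fun t => ENNReal.ofReal (t ^ (q - 1))) t := by
  by_cases ha : a = ∞
  · subst ha
    rw [ENNReal.top_rpow_of_pos hq]
    refine ENNReal.le_of_forall_nnreal_lt fun b _ => ?_
    have h := lintegral_Ioi_indicator_rpow (a := (b : ℝ≥0∞) ^ q⁻¹)
      (ENNReal.rpow_ne_top_of_nonneg (by positivity) (by simp)) hq
    rw [← ENNReal.rpow_mul, inv_mul_cancel₀ hq.ne', ENNReal.rpow_one] at h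
    rw [h]
    gcongr ENNReal.ofReal q * ?_
    refine lintegral_mono fun t => ?_
    exact indicator_le_indicator_of_subset (fun t _ => ENNReal.ofReal_lt_top)
      (fun _ => zero_le) t
  · exact (lintegral_Ioi_indicator_rpow ha hq).le

/-- The strong type inequality for the Hardy–Littlewood maximal function. -/
theorem lintegral_hlMaximal_rpow_le {q : ℝ} (hq : 1 < q) {u : R3 → ℝ≥0∞} (hu : Measurable u) :
    ∫⁻ x, hlMaximal u x ^ q ≤
      ENNReal.ofReal (128 * q * 2 ^ (q - 1) / (q - 1)) * ∫⁻ x, u x ^ q := by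
  have hq0 : 0 < q := by linarith
  have hq1 : 0 < q - 1 := by linarith
  have hM := measurable_hlMaximal u
  have meas : ∀ (v : R3 → ℝ≥0∞), Measurable v → ∀ (s : ℝ), Measurable fun z : R3 × ℝ =>
      {t : ℝ | ENNReal.ofReal t < v z.1}.indicator (fun t => ENNReal.ofReal (t ^ s)) z.2 := by
    intro v hv s
    have : MeasurableSet {z : R3 × ℝ | ENNReal.ofReal z.2 < v z.1} :=
      measurableSet_lt (by fun_prop) (by fun_prop)
    exact (show Measurable fun z : R3 × ℝ => ENNReal.ofReal (z.2 ^ s) by fun_prop).indicator this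
  calc ∫⁻ x, hlMaximal u x ^ q
      ≤ ∫⁻ x, ENNReal.ofReal q * ∫⁻ t in Ioi (0 : ℝ),
        {t : ℝ | ENNReal.ofReal t < hlMaximal u x}.indicator
          (fun t => ENNReal.ofReal (t ^ (q - 1))) t :=
        lintegral_mono fun x => rpow_le_lintegral_Ioi_indicator _ hq0
    _ = ENNReal.ofReal q * ∫⁻ t in Ioi (0 : ℝ), ∫⁻ x,
        {t : ℝ | ENNReal.ofReal t < hlMaximal u x}.indicator
          (fun t => ENNReal.ofReal (t ^ (q - 1))) t := by
        rw [lintegral_const_mul' _ _ (by simp), lintegral_lintegral_swap]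
        exact (meas _ hM _).aemeasurable
    _ ≤ ENNReal.ofReal q * ∫⁻ t in Ioi (0 : ℝ), 128 * ∫⁻ x,
        {t : ℝ | ENNReal.ofReal t < 2 * u x}.indicator
          (fun t => ENNReal.ofReal (t ^ (q - 2))) t * u x := by
        gcongr ENNReal.ofReal q * ?_
        refine setLIntegral_mono' measurableSet_Ioi fun t ht => ?_
        have ht : 0 < t := ht
        have hS : MeasurableSet {x | ENNReal.ofReal t < hlMaximal u x} :=
          measurableSet_lt measurable_const hM
        have hS' : MeasurableSet {x | ENNReal.ofReal t < 2 * u x} :=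
          measurableSet_lt measurable_const (hu.const_mul 2)
        have e1 : ∀ x, {t : ℝ | ENNReal.ofReal t < hlMaximal u x}.indicator
            (fun t => ENNReal.ofReal (t ^ (q - 1))) t =
            {x | ENNReal.ofReal t < hlMaximal u x}.indicator
            (fun _ => ENNReal.ofReal (t ^ (q - 1))) x := fun x => by simp [indicator]
        have e2 : ∀ x, {t : ℝ | ENNReal.ofReal t < 2 * u x}.indicator
            (fun t => ENNReal.ofReal (t ^ (q - 2))) t * u x =
            {x | ENNReal.ofReal t < 2 * u x}.indicator
            (fun x => ENNReal.ofReal (t ^ (q - 2)) * u x) x := fun x => by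
          simp [indicator]
        simp_rw [e1, e2]
        rw [lintegral_indicator hS, lintegral_indicator hS', setLIntegral_const,
          lintegral_const_mul _ hu, mul_left_comm]
        -- One factor `t` is split off to be spent on the weak type inequality at height `t`.
        have e3 : t ^ (q - 1) = t ^ (q - 2) * t := by
          rw [← Real.rpow_add_one ht.ne']; ring_nf
        rw [e3, ENNReal.ofReal_mul (by positivity), mul_assoc]
        gcongr ENNReal.ofReal (t ^ (q - 2)) * ?_
        exact mul_volume_lt_hlMaximal_le_setLIntegral hu ht
    _ = ENNReal.ofReal q * 128 * ∫⁻ x, (∫⁻ t in Ioi (0 : ℝ),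
        {t : ℝ | ENNReal.ofReal t < 2 * u x}.indicator
          (fun t => ENNReal.ofReal (t ^ (q - 2))) t) * u x := by
        rw [lintegral_const_mul' _ _ (by simp), mul_assoc, lintegral_lintegral_swap]
        · congr! 4 with x
          exact lintegral_mul_const _ ((meas _ (hu.const_mul 2) _).comp measurable_prodMk_left)
        · exact (((meas _ (hu.const_mul 2) _).comp measurable_swap).mul
            (hu.comp measurable_snd)).aemeasurable
    _ ≤ ENNReal.ofReal q * 128 * ∫⁻ x, ENNReal.ofReal (2 ^ (q - 1) / (q - 1)) * u x ^ q := by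
        gcongr ENNReal.ofReal q * 128 * ?_
        refine lintegral_mono fun x => ?_
        by_cases hx : u x = ∞
        · simp [hx, ENNReal.top_rpow_of_pos hq0, ENNReal.mul_top, show
            0 < 2 ^ (q - 1) / (q - 1) by positivity]
        have h := lintegral_Ioi_indicator_rpow (a := 2 * u x) (ENNReal.mul_ne_top (by simp) hx) hq1
        rw [show q - 1 - 1 = q - 2 by ring] at h
        have h2 : (∫⁻ t in Ioi (0 : ℝ), {t : ℝ | ENNReal.ofReal t < 2 * u x}.indicator
          (fun t => ENNReal.ofReal (t ^ (q - 2))) t) =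
            (ENNReal.ofReal (q - 1))⁻¹ * (2 * u x) ^ (q - 1) := by
          rw [h, ← mul_assoc, ENNReal.inv_mul_cancel (by simpa using hq) (by simp), one_mul]
        rw [h2, ENNReal.mul_rpow_of_nonneg _ _ hq1.le, div_eq_mul_inv,
          ENNReal.ofReal_mul (by positivity), ENNReal.ofReal_inv_of_pos hq1,
          ← ENNReal.ofReal_rpow_of_pos (by norm_num)]
        have e4 : u x ^ q = u x ^ (q - 1) * u x := by
          nth_rw 3 [← ENNReal.rpow_one (u x)]
          rw [← ENNReal.rpow_add_of_nonneg _ _ hq1.le zero_le_one]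
          ring_nf
        rw [e4]
        simp only [ENNReal.ofReal_ofNat]
        exact le_of_eq (by ring)
    _ = _ := by
        rw [lintegral_const_mul' _ _ (by simp), ← mul_assoc]
        congr 1
        rw [show (128 : ℝ≥0∞) = ENNReal.ofReal 128 by simp,
          ← ENNReal.ofReal_mul (by positivity), ← ENNReal.ofReal_mul (by positivity)]
        congr 1
        ring

/-! ### The maximal functions of `r`-averages -/

theorem lowerSemicontinuous_rMaximal {r : ℝ} (hr : 0 < r) (h : R3 → ℂ) :
    LowerSemicontinuous (rMaximal r h) := by
  intro x c hc
  have key : ∀ z, c < rMaximal r h z ↔ c ^ r < hlMaximal (fun y => ‖h y‖ₑ ^ r) z := by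
    intro z
    rw [rMaximal, ← ENNReal.rpow_lt_rpow_iff hr, ← ENNReal.rpow_mul, one_div,
      inv_mul_cancel₀ hr.ne', ENNReal.rpow_one]
  filter_upwards [lowerSemicontinuous_hlMaximal _ x _ ((key x).1 hc)] with z hz
  exact (key z).2 hz

theorem measurable_rMaximal (r : ℝ) (h : R3 → ℂ) : Measurable (rMaximal r h) :=
  (measurable_hlMaximal _).pow_const _

theorem rpow_setLAverage_le_rMaximal {r : ℝ} (hr : 0 < r) (u : R3 → ℂ) (x : R3) {ρ : ℝ}
    (hρ : 0 < ρ) :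
    (⨍⁻ y in Metric.ball x ρ, ‖u y‖ₑ ^ r ∂volume) ^ (1 / r) ≤ rMaximal r u x :=
  ENNReal.rpow_le_rpow (setLAverage_le_hlMaximal _ x hρ) (by positivity)

theorem rMaximal_le_of_forall {r : ℝ} (hr : 0 < r) {u : R3 → ℂ} {x : R3} {c : ℝ≥0∞}
    (h : ∀ ρ : ℝ, 0 < ρ → (⨍⁻ y in Metric.ball x ρ, ‖u y‖ₑ ^ r ∂volume) ^ (1 / r) ≤ c) :
    rMaximal r u x ≤ c := by
  rw [rMaximal, one_div, ENNReal.rpow_inv_le_iff hr]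
  refine iSup₂_le fun ρ hρ => ?_
  rw [← ENNReal.rpow_inv_le_iff hr, ← one_div]
  exact h ρ hρ

theorem rMaximal_add_le {r : ℝ} (hr : 1 ≤ r) {u v : R3 → ℂ} (hu : Measurable u)
    (hv : Measurable v) (x : R3) :
    rMaximal r (fun y => u y + v y) x ≤ rMaximal r u x + rMaximal r v x := by
  have hr0 : 0 < r := by linarith
  refine rMaximal_le_of_forall hr0 fun ρ hρ => ?_
  refine le_trans ?_ (add_le_add (rpow_setLAverage_le_rMaximal hr0 u x hρ)
    (rpow_setLAverage_le_rMaximal hr0 v x hρ))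
  refine le_trans ?_ (ENNReal.lintegral_Lp_add_le (f := fun y => ‖u y‖ₑ) (g := fun y => ‖v y‖ₑ)
    hu.enorm.aemeasurable hv.enorm.aemeasurable hr)
  rw [laverage]
  gcongr with y
  exact enorm_add_le _ _

theorem rMaximal_zero {r : ℝ} (hr : 0 < r) (x : R3) : rMaximal r (fun _ => 0) x = 0 := by
  have : hlMaximal (fun _ => (0 : ℝ≥0∞)) x = 0 := le_antisymm (hlMaximal_le_const (by simp) x) zero_le
  simp [rMaximal, ENNReal.zero_rpow_of_pos hr, this, hr]

theorem rMaximal_le_const {r : ℝ} (hr : 0 < r) {u : R3 → ℂ} {c : ℝ≥0∞}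
    (h : ∀ y, ‖u y‖ₑ ≤ c) (x : R3) : rMaximal r u x ≤ c := by
  rw [rMaximal, one_div, ENNReal.rpow_inv_le_iff hr]
  exact hlMaximal_le_const (fun y => ENNReal.rpow_le_rpow (h y) hr.le) x

theorem hlMaximal_mul_const_le (u : R3 → ℝ≥0∞) {c : ℝ≥0∞} (hc : c ≠ ∞) (x : R3) :
    hlMaximal (fun y => u y * c) x ≤ hlMaximal u x * c := by
  refine iSup₂_le fun ρ hρ => ?_
  rw [laverage, lintegral_mul_const' _ _ hc]
  gcongr
  exact setLAverage_le_hlMaximal u x hρ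

/-- Pointwise |u|^s ≤ |u|^r c^{s-r}. This is how averages of order 2 are reached from orders below
2, at the price of a sup norm. -/
theorem rMaximal_le_rMaximal_rpow_mul {r s : ℝ} (hr : 0 < r) (hrs : r ≤ s) {u : R3 → ℂ}
    {c : ℝ≥0∞} (hc : c ≠ ∞) (h : ∀ y, ‖u y‖ₑ ≤ c) (x : R3) :
    rMaximal s u x ≤ rMaximal r u x ^ (r / s) * c ^ (1 - r / s) := by
  have hs : 0 < s := hr.trans_le hrs
  have h1 : hlMaximal (fun y => ‖u y‖ₑ ^ s) x ≤
      hlMaximal (fun y => ‖u y‖ₑ ^ r) x * c ^ (s - r) := by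
    refine le_trans (hlMaximal_mono (v := fun y => ‖u y‖ₑ ^ r * c ^ (s - r)) (fun y => ?_) x)
      (hlMaximal_mul_const_le _ (ENNReal.rpow_ne_top_of_nonneg (by linarith) hc) x)
    calc ‖u y‖ₑ ^ s = ‖u y‖ₑ ^ r * ‖u y‖ₑ ^ (s - r) := by
          rw [← ENNReal.rpow_add_of_nonneg _ _ hr.le (by linarith)]; ring_nf
      _ ≤ _ := by
        gcongr
        exact h y
  rw [rMaximal, rMaximal]
  refine (ENNReal.rpow_le_rpow h1 (by positivity)).trans (le_of_eq ?_)
  rw [ENNReal.mul_rpow_of_nonneg _ _ (by positivity), ← ENNReal.rpow_mul, ← ENNReal.rpow_mul]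
  congr 2 <;> field_simp

open Filter in
-- Fatou's lemma on each ball. As the averages are over solid balls, convergence almost everywhere
-- in space gives a bound at every point, in particular on the sphere, which is a null set.
theorem rMaximal_le_liminf {r : ℝ} (hr : 0 < r) {u : ℕ → R3 → ℂ} {v : R3 → ℂ}
    (hu : ∀ n, Measurable (u n))
    (h : ∀ᵐ y ∂volume, Tendsto (fun n => u n y) atTop (nhds (v y))) (x : R3) :
    rMaximal r v x ≤ liminf (fun n => rMaximal r (u n) x) atTop := by
  refine rMaximal_le_of_forall hr fun ρ hρ => ?_
  have h1 : ⨍⁻ y in Metric.ball x ρ, ‖v y‖ₑ ^ r ∂volume ≤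
      liminf (fun n => hlMaximal (fun y => ‖u n y‖ₑ ^ r) x) atTop := by
    calc ⨍⁻ y in Metric.ball x ρ, ‖v y‖ₑ ^ r ∂volume
        = ⨍⁻ y in Metric.ball x ρ, liminf (fun n => ‖u n y‖ₑ ^ r) atTop ∂volume := by
          refine laverage_congr (ae_restrict_of_ae ?_)
          filter_upwards [h] with y hy
          exact ((ENNReal.continuous_rpow_const.tendsto _).comp hy.enorm).liminf_eq.symm
      _ ≤ liminf (fun n => ⨍⁻ y in Metric.ball x ρ, ‖u n y‖ₑ ^ r ∂volume) atTop :=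
          lintegral_liminf_le fun n => (hu n).enorm.pow_const _
      _ ≤ _ := liminf_le_liminf (Eventually.of_forall fun n => setLAverage_le_hlMaximal _ x hρ)
  refine (ENNReal.rpow_le_rpow h1 (by positivity)).trans (le_of_eq ?_)
  exact (ENNReal.orderIsoRpow (1 / r) (by positivity)).liminf_apply

theorem rMaximal_eq_iSup_rat {r : ℝ} (hr : 0 < r) (u : R3 → ℂ) (x : R3) :
    rMaximal r u x = ⨆ q : {q : ℚ // 0 < q},
      (⨍⁻ y in Metric.ball x (q : ℝ), ‖u y‖ₑ ^ r ∂volume) ^ (1 / r) := by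
  rw [rMaximal, hlMaximal_eq_iSup_rat]
  exact (ENNReal.orderIsoRpow (1 / r) (by positivity)).map_iSup _

/-! ### Fourier transforms of integrable functions -/

theorem continuous_fourier {f : R3 → ℂ} (hf : Integrable f) : Continuous (𝓕 f) :=
  VectorFourier.fourierIntegral_continuous Real.continuous_fourierChar continuous_inner hf

theorem enorm_fourier_le (f : R3 → ℂ) (ξ : R3) : ‖𝓕 f ξ‖ₑ ≤ ∫⁻ x, ‖f x‖ₑ := by
  rw [Real.fourier_eq]
  refine (enorm_integral_le_lintegral_enorm _).trans (le_of_eq ?_)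
  congr! 2 with x
  rw [← ofReal_norm, Circle.norm_smul, ofReal_norm]

theorem integral_fourier_mul_eq {f g : R3 → ℂ} (hf : Integrable f) (hg : Integrable g) :
    ∫ ξ, 𝓕 f ξ * g ξ = ∫ x, f x * 𝓕 g x := by
  simpa using! VectorFourier.integral_bilin_fourierIntegral_eq_flip (.mul ℂ ℂ) (L := innerₗ R3)
    Real.continuous_fourierChar continuous_inner hf hg

theorem fourier_integral_add {f g : R3 → ℂ} (hf : Integrable f) (hg : Integrable g) (ξ : R3) :
    𝓕 (fun x => f x + g x) ξ = 𝓕 f ξ + 𝓕 g ξ :=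
  congrFun (VectorFourier.fourierIntegral_add (L := innerₗ R3) Real.continuous_fourierChar
    continuous_inner hf hg) ξ

theorem fourier_integral_zero (ξ : R3) : 𝓕 (fun _ : R3 => (0 : ℂ)) ξ = 0 := by
  simp [Real.fourier_eq]

theorem fourier_integral_sum {ι : Type*} (s : Finset ι) {f : ι → R3 → ℂ} (hf : ∀ i, Integrable (f i))
    (ξ : R3) : 𝓕 (fun x => ∑ i ∈ s, f i x) ξ = ∑ i ∈ s, 𝓕 (f i) ξ := by
  classical
  induction s using Finset.induction_on with
  | empty => simp [fourier_integral_zero]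
  | insert a s ha ih =>
    simp only [Finset.sum_insert ha]
    rw [fourier_integral_add (hf a) (integrable_finsetSum s fun i _ => hf i), ih]

/-- On `L¹ ∩ L²` the Plancherel transform is given by the Fourier integral. -/
theorem fourier_toLp_ae_eq {f : R3 → ℂ} (hf : Integrable f) (hf2 : MemLp f 2 volume) :
    (𝓕 (hf2.toLp f) : Lp ℂ 2 (volume : Measure R3)) =ᵐ[volume] 𝓕 f := by
  -- Both sides are locally integrable, so it suffices to test against smooth compactly supported
  -- functions. There the two transforms agree by the multiplication formula.
  refine ae_eq_of_integral_contDiff_smul_eq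
    ((Lp.memLp _).locallyIntegrable (by norm_num)) (continuous_fourier hf).locallyIntegrable
    fun g g_smooth g_cpt => ?_
  have hg₁ : HasCompactSupport (Complex.ofRealCLM ∘ g) := g_cpt.comp_left rfl
  have hg₂ : ContDiff ℝ (⊤ : ℕ∞) (Complex.ofRealCLM ∘ g) := by fun_prop
  let φ := hg₁.toSchwartzMap hg₂
  have hφ : ∀ x, φ x = (g x : ℂ) := fun x => rfl
  have h1 := DFunLike.congr_fun (Lp.fourier_toTemperedDistribution_eq (hf2.toLp f)) φ
  rw [TemperedDistribution.fourier_apply, Lp.toTemperedDistribution_apply,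
    Lp.toTemperedDistribution_apply] at h1
  calc ∫ x, g x • (𝓕 (hf2.toLp f) : Lp ℂ 2 (volume : Measure R3)) x
      = ∫ x, φ x • (𝓕 (hf2.toLp f) : Lp ℂ 2 (volume : Measure R3)) x := by simp [hφ]
    _ = ∫ x, (𝓕 φ) x • hf2.toLp f x := h1.symm
    _ = ∫ x, 𝓕 (φ : R3 → ℂ) x * f x := by
        refine integral_congr_ae ?_
        filter_upwards [hf2.coeFn_toLp] with x hx
        rw [hx, smul_eq_mul, SchwartzMap.fourier_coe]
    _ = ∫ x, φ x * 𝓕 f x := integral_fourier_mul_eq φ.integrable hf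
    _ = ∫ x, g x • 𝓕 f x := by simp [hφ]

theorem eLpNorm_fourier_eq {f : R3 → ℂ} (hf : Integrable f) (hf2 : MemLp f 2 volume) :
    eLpNorm (𝓕 f) 2 volume = eLpNorm f 2 volume := by
  rw [← eLpNorm_congr_ae (fourier_toLp_ae_eq hf hf2), ← Lp.enorm_def, ← ofReal_norm,
    Lp.norm_fourier_eq, ofReal_norm, Lp.enorm_def, eLpNorm_congr_ae hf2.coeFn_toLp]

theorem eLpNorm_two_sq {α : Type*} {_ : MeasurableSpace α} {E : Type*} [TopologicalSpace E]
    [ContinuousENorm E] (f : α → E) (μ : Measure α) :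
    eLpNorm f 2 μ ^ 2 = ∫⁻ x, ‖f x‖ₑ ^ 2 ∂μ := by
  rw [eLpNorm_eq_lintegral_rpow_enorm_toReal (by norm_num) (by norm_num)]
  simp only [ENNReal.toReal_ofNat, one_div]
  rw [← ENNReal.rpow_natCast (_ ^ _), ← ENNReal.rpow_mul]
  norm_num

/-- The square of 𝓕 F is the Fourier transform of F * F, so Plancherel turns the fourth power into
the squared `L²` norm of F * F. Taking absolute values inside the convolution discards the phase of
F. -/
theorem lintegral_enorm_fourier_pow_four_le {F : R3 → ℂ} (hF : Integrable F) :
    ∫⁻ ξ, ‖𝓕 F ξ‖ₑ ^ 4 ≤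
      ∫⁻ x, (lconvolution (fun y => ‖F y‖ₑ) (fun y => ‖F y‖ₑ) volume x) ^ 2 := by
  set K : R3 → ℂ := convolution F F (ContinuousLinearMap.mul ℂ ℂ) volume with hK
  have hKi : Integrable K := hF.integrable_convolution _ hF
  have hle : ∀ x, ‖K x‖ₑ ≤ lconvolution (fun y => ‖F y‖ₑ) (fun y => ‖F y‖ₑ) volume x := by
    intro x
    refine (enorm_integral_le_lintegral_enorm _).trans (le_of_eq ?_)
    simp only [ContinuousLinearMap.mul_apply', enorm_mul, lconvolution_def]
    simp only [sub_eq_neg_add]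
  have hle2 : ∫⁻ x, ‖K x‖ₑ ^ 2 ≤
      ∫⁻ x, (lconvolution (fun y => ‖F y‖ₑ) (fun y => ‖F y‖ₑ) volume x) ^ 2 := by
    gcongr with x
    exact hle x
  by_cases htop : ∫⁻ x, (lconvolution (fun y => ‖F y‖ₑ) (fun y => ‖F y‖ₑ) volume x) ^ 2 = ∞
  · rw [htop]; exact le_top
  have hK2 : MemLp K 2 volume := by
    refine ⟨hKi.aestronglyMeasurable, lt_top_iff_ne_top.2 fun h => ?_⟩
    have := eLpNorm_two_sq K volume
    rw [h, ENNReal.top_pow (by norm_num)] at this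
    exact htop (top_le_iff.1 (this ▸ hle2))
  calc ∫⁻ ξ, ‖𝓕 F ξ‖ₑ ^ 4 = ∫⁻ ξ, ‖𝓕 K ξ‖ₑ ^ 2 := by
        congr! 2 with ξ
        rw [hK, Real.fourier_mul_convolution_eq hF hF, enorm_mul]
        ring
    _ = ∫⁻ x, ‖K x‖ₑ ^ 2 := by
        rw [← eLpNorm_two_sq, eLpNorm_fourier_eq hKi hK2, eLpNorm_two_sq]
    _ ≤ _ := hle2

theorem enorm_integral_fourier_mul_le {f F : R3 → ℂ} (hf : Integrable f) (hF : Integrable F) :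
    ‖∫ ξ, 𝓕 f ξ * F ξ‖ₑ ≤ eLpNorm f (4 / 3) volume *
      (∫⁻ x, (lconvolution (fun y => ‖F y‖ₑ) (fun y => ‖F y‖ₑ) volume x) ^ 2) ^ (1 / 4 : ℝ) := by
  have hpq : (4 / 3 : ℝ).HolderConjugate 4 := by
    rw [Real.holderConjugate_iff]; norm_num
  have h43 : (4 / 3 : ℝ≥0∞).toReal = 4 / 3 := by simp
  rw [integral_fourier_mul_eq hf hF]
  calc _ ≤ ∫⁻ x, ‖f x‖ₑ * ‖𝓕 F x‖ₑ := by
        refine (enorm_integral_le_lintegral_enorm _).trans (le_of_eq ?_)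
        simp [enorm_mul]
    _ ≤ (∫⁻ x, ‖f x‖ₑ ^ (4 / 3 : ℝ)) ^ (1 / (4 / 3) : ℝ) *
        (∫⁻ x, ‖𝓕 F x‖ₑ ^ (4 : ℝ)) ^ (1 / 4 : ℝ) :=
        ENNReal.lintegral_mul_le_Lp_mul_Lq volume hpq hf.aestronglyMeasurable.enorm
          (continuous_fourier hF).measurable.enorm.aemeasurable
    _ ≤ _ := by
        rw [eLpNorm_eq_lintegral_rpow_enorm_toReal (by simp)
          (ENNReal.div_ne_top (by simp) (by simp)), h43]
        gcongr _ * ?_ ^ (_ : ℝ)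
        refine le_trans (le_of_eq ?_) (lintegral_enorm_fourier_pow_four_le hF)
        congr! 2 with x
        exact_mod_cast ENNReal.rpow_natCast ‖𝓕 F x‖ₑ 4

/-! ### Linearised maximal averages -/

/-- The normalised indicator function of the ball of radius `ρ ω` around `ω`. -/
def ballKernel (ρ : R3 → ℝ) (ω x : R3) : ℝ≥0∞ :=
  (Metric.ball ω (ρ ω)).indicator (fun _ => (volume (Metric.ball ω (ρ ω)))⁻¹) x

theorem measurable_ballKernel {ρ : R3 → ℝ} (hρ : Measurable ρ) :
    Measurable (Function.uncurry (ballKernel ρ)) := by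
  have h1 : MeasurableSet {z : R3 × R3 | dist z.2 z.1 < ρ z.1} :=
    measurableSet_lt (by fun_prop) (by fun_prop)
  have h2 : Measurable fun z : R3 × R3 => (volume (Metric.ball z.1 (ρ z.1)))⁻¹ := by
    simp only [EuclideanSpace.volume_ball_fin_three]
    fun_prop
  convert! h2.indicator h1 using 1

theorem lintegral_mul_ballKernel (ρ : R3 → ℝ) (g : R3 → ℝ≥0∞) (hg : Measurable g) (ω : R3) :
    ∫⁻ x, g x * ballKernel ρ ω x = ⨍⁻ x in Metric.ball ω (ρ ω), g x ∂volume := by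
  have : ∀ x, g x * ballKernel ρ ω x =
      (Metric.ball ω (ρ ω)).indicator (fun x => g x * (volume (Metric.ball ω (ρ ω)))⁻¹) x := by
    intro x
    by_cases h : x ∈ Metric.ball ω (ρ ω) <;> simp [ballKernel, h]
  simp_rw [this]
  rw [lintegral_indicator measurableSet_ball, lintegral_mul_const _ hg, setLAverage_eq,
    div_eq_mul_inv]

/-- The average of order `r` of `u` over the ball of radius `ρ ω` around `ω`. -/
def ballAverage (r : ℝ) (u : R3 → ℂ) (ρ : R3 → ℝ) (ω : R3) : ℝ≥0∞ :=
  (⨍⁻ x in Metric.ball ω (ρ ω), ‖u x‖ₑ ^ r ∂volume) ^ (1 / r)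

theorem measurable_ballAverage {r : ℝ} {u : R3 → ℂ} (hu : Measurable u) {ρ : R3 → ℝ}
    (hρ : Measurable ρ) : Measurable (ballAverage r u ρ) := by
  refine Measurable.pow_const ?_ _
  simp_rw [← lintegral_mul_ballKernel ρ (fun x => ‖u x‖ₑ ^ r) (hu.enorm.pow_const _)]
  have := measurable_ballKernel hρ
  have h2 : Measurable fun z : R3 × R3 => ‖u z.2‖ₑ ^ r * ballKernel ρ z.1 z.2 :=
    ((hu.comp measurable_snd).enorm.pow_const _).mul this
  exact h2.lintegral_prod_right'

theorem ballAverage_le {r : ℝ} (hr : 0 < r) {u : R3 → ℂ} {ρ : R3 → ℝ} {ω : R3} (hρ : 0 < ρ ω)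
    {c : ℝ≥0∞} (hc : ∀ x, ‖u x‖ₑ ≤ c) : ballAverage r u ρ ω ≤ c :=
  (rpow_setLAverage_le_rMaximal hr u ω hρ).trans (rMaximal_le_const hr hc ω)

/-- The density which linearises `ballAverage r u ρ ω ^ 2`. -/
def dualDensity (r : ℝ) (u : R3 → ℂ) (ρ : R3 → ℝ) (ω x : R3) : ℝ≥0∞ :=
  ballAverage r u ρ ω ^ (2 - r) * ‖u x‖ₑ ^ (r - 1) * ballKernel ρ ω x

theorem measurable_dualDensity {r : ℝ} {u : R3 → ℂ} (hu : Measurable u) {ρ : R3 → ℝ}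
    (hρ : Measurable ρ) : Measurable (Function.uncurry (dualDensity r u ρ)) :=
  ((((measurable_ballAverage hu hρ).comp measurable_fst).pow_const _).mul
    ((hu.comp measurable_snd).enorm.pow_const _)).mul (measurable_ballKernel hρ)

/-- The exponents in the density are balanced for this identity: the average of |u|^r is A^r, and
A^{2-r} A^r = A². -/
theorem lintegral_enorm_mul_dualDensity {r : ℝ} (hr : 1 ≤ r) (hr2 : r < 2) {u : R3 → ℂ}
    (hu : Measurable u) (ρ : R3 → ℝ) (ω : R3) :
    ∫⁻ x, ‖u x‖ₑ * dualDensity r u ρ ω x = ballAverage r u ρ ω ^ 2 := by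
  have hr0 : 0 < r := by linarith
  have h1 : ∀ x, ‖u x‖ₑ * dualDensity r u ρ ω x =
      ballAverage r u ρ ω ^ (2 - r) * (‖u x‖ₑ ^ r * ballKernel ρ ω x) := by
    intro x
    have : ‖u x‖ₑ ^ r = ‖u x‖ₑ * ‖u x‖ₑ ^ (r - 1) := by
      nth_rw 2 [← ENNReal.rpow_one ‖u x‖ₑ]
      rw [← ENNReal.rpow_add_of_nonneg _ _ zero_le_one (by linarith)]
      ring_nf
    rw [this, dualDensity]
    ring
  simp_rw [h1]
  rw [lintegral_const_mul, lintegral_mul_ballKernel _ _ (hu.enorm.pow_const _)]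
  · have : ⨍⁻ x in Metric.ball ω (ρ ω), ‖u x‖ₑ ^ r ∂volume = ballAverage r u ρ ω ^ r := by
      rw [ballAverage, ← ENNReal.rpow_mul, one_div, inv_mul_cancel₀ hr0.ne', ENNReal.rpow_one]
    rw [this, ← ENNReal.rpow_add_of_nonneg _ _ (by linarith) hr0.le, ← ENNReal.rpow_natCast]
    norm_num
  · have h : Measurable (ballKernel ρ ω) := measurable_const.indicator measurableSet_ball
    exact (hu.enorm.pow_const _).mul h

theorem lintegral_mul_dualDensity_le {r : ℝ} (hr : 1 ≤ r) (hr2 : r < 2) {u : R3 → ℂ}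
    (hu : Measurable u) (ρ : R3 → ℝ) (ω : R3) {k : R3 → ℝ≥0∞} (hk : Measurable k) :
    ∫⁻ x, k x * dualDensity r u ρ ω x ≤
      ballAverage r u ρ ω * (⨍⁻ x in Metric.ball ω (ρ ω), k x ^ r ∂volume) ^ (1 / r) := by
  have hr0 : 0 < r := by linarith
  have hW : Measurable (ballKernel ρ ω) := measurable_const.indicator measurableSet_ball
  have h1 : ∀ x, k x * dualDensity r u ρ ω x =
      ballAverage r u ρ ω ^ (2 - r) * ((k x * ‖u x‖ₑ ^ (r - 1)) * ballKernel ρ ω x) := by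
    intro x
    rw [dualDensity]
    ring
  simp_rw [h1]
  rw [lintegral_const_mul, lintegral_mul_ballKernel _ (fun x => k x * ‖u x‖ₑ ^ (r - 1))
    (hk.mul (hu.enorm.pow_const _))]
  swap; · exact (hk.mul (hu.enorm.pow_const _)).mul hW
  -- Hölder in the form with weights 1/r and (r-1)/r, which includes r = 1, where the second weight
  -- vanishes.
  have h2 := ENNReal.lintegral_mul_norm_pow_le
    (μ := (volume.restrict (Metric.ball ω (ρ ω)) univ)⁻¹ • volume.restrict (Metric.ball ω (ρ ω)))
    (f := fun x => k x ^ r) (g := fun x => ‖u x‖ₑ ^ r)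
    (hk.pow_const _).aemeasurable (hu.enorm.pow_const _).aemeasurable
    (p := 1 / r) (q := (r - 1) / r) (by positivity) (div_nonneg (by linarith) hr0.le)
    (by field_simp; ring)
  have e1 : ∀ x, (k x ^ r) ^ (1 / r) = k x := fun x => by
    rw [← ENNReal.rpow_mul, mul_one_div_cancel hr0.ne', ENNReal.rpow_one]
  have e2 : ∀ x, (‖u x‖ₑ ^ r) ^ ((r - 1) / r) = ‖u x‖ₑ ^ (r - 1) := fun x => by
    rw [← ENNReal.rpow_mul, mul_div_cancel₀ _ hr0.ne']
  simp_rw [e1, e2] at h2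
  have e3 : (⨍⁻ x in Metric.ball ω (ρ ω), ‖u x‖ₑ ^ r ∂volume) ^ ((r - 1) / r) =
      ballAverage r u ρ ω ^ (r - 1) := by
    rw [ballAverage, ← ENNReal.rpow_mul]
    congr 1
    ring
  have e4 : ballAverage r u ρ ω = ballAverage r u ρ ω ^ (2 - r) * ballAverage r u ρ ω ^ (r - 1) := by
    rw [← ENNReal.rpow_add_of_nonneg _ _ (by linarith) (by linarith)]
    norm_num
  calc _ ≤ ballAverage r u ρ ω ^ (2 - r) *
        ((⨍⁻ x in Metric.ball ω (ρ ω), k x ^ r ∂volume) ^ (1 / r) *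
          (⨍⁻ x in Metric.ball ω (ρ ω), ‖u x‖ₑ ^ r ∂volume) ^ ((r - 1) / r)) := by
        gcongr _ * ?_
        exact h2
    _ = _ := by
        rw [e3]
        conv_rhs => rw [e4]
        ring

theorem lintegral_dualDensity_le {r : ℝ} (hr : 1 ≤ r) (hr2 : r < 2) {u : R3 → ℂ}
    (hu : Measurable u) (ρ : R3 → ℝ) (ω : R3) :
    ∫⁻ x, dualDensity r u ρ ω x ≤ ballAverage r u ρ ω := by
  have h := lintegral_mul_dualDensity_le hr hr2 hu ρ ω (k := fun _ => 1) measurable_const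
  have h2 : ⨍⁻ _ in Metric.ball ω (ρ ω), (1 : ℝ≥0∞) ^ r ∂volume ≤ 1 := by
    rw [setLAverage_eq]
    simp [ENNReal.div_self_le_one]
  calc _ = ∫⁻ x, 1 * dualDensity r u ρ ω x := by simp
    _ ≤ _ := h
    _ ≤ ballAverage r u ρ ω * 1 ^ (1 / r) := by gcongr
    _ = _ := by simp

/-- For y in the smaller ball, the translate by y of the larger ball lies in the ball of doubled
radius around ω + ω', whose volume is 8 times as large. -/
theorem setLAverage_ball_comp_add_le (g : R3 → ℝ≥0∞) {ω ω' y : R3} {s s' : ℝ} (hs : 0 < s)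
    (hs' : s' ≤ s) (hy : y ∈ Metric.ball ω' s') :
    ⨍⁻ x in Metric.ball ω s, g (x + y) ∂volume ≤ 8 * hlMaximal g (ω + ω') := by
  have h1 : ∫⁻ x in Metric.ball ω s, g (x + y) ≤ ∫⁻ z in Metric.ball (ω + ω') (2 * s), g z := by
    rw [← lintegral_indicator measurableSet_ball, ← lintegral_indicator measurableSet_ball]
    calc ∫⁻ x, (Metric.ball ω s).indicator (fun x => g (x + y)) x
        ≤ ∫⁻ x, (Metric.ball (ω + ω') (2 * s)).indicator g (x + y) := by
          refine lintegral_mono fun x => ?_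
          by_cases hx : x ∈ Metric.ball ω s
          · have : x + y ∈ Metric.ball (ω + ω') (2 * s) := by
              rw [Metric.mem_ball] at *
              linarith [dist_add_add_le x y ω ω']
            simp [hx, this]
          · simp [hx]
      _ = _ := lintegral_add_right_eq_self _ y
  refine le_trans ?_ (mul_le_mul_right (setLAverage_le_hlMaximal g (ω + ω')
    (ρ := 2 * s) (by positivity)) 8)
  rw [setLAverage_eq, setLAverage_eq, volume_ball_two_mul (ω + ω') ω]
  refine (ENNReal.div_le_div_right h1 _).trans (le_of_eq ?_)
  rw [div_eq_mul_inv, div_eq_mul_inv, ENNReal.mul_inv (Or.inl (by norm_num))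
    (Or.inl (by norm_num)), mul_left_comm, ← mul_assoc 8, ENNReal.mul_inv_cancel (by norm_num)
    (by norm_num), one_mul]

/-- The variable of the larger ball is integrated first: for every fixed y in the smaller ball this
already produces the maximal function at ω + ω'. The integral in y then costs only the mass of the
second density. -/
theorem lintegral_lintegral_dualDensity_le_of_le {r : ℝ} (hr : 1 ≤ r) (hr2 : r < 2) {u : R3 → ℂ}
    (hu : Measurable u) {ρ : R3 → ℝ} (hpos : ∀ ω, 0 < ρ ω)
    {H : R3 → ℝ≥0∞} (hH : Measurable H) {ω ω' : R3} (h : ρ ω' ≤ ρ ω) :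
    ∫⁻ y, (∫⁻ x, H (x + y) * dualDensity r u ρ ω x) * dualDensity r u ρ ω' y ≤
      8 * (ballAverage r u ρ ω * ballAverage r u ρ ω' *
        hlMaximal (fun z => H z ^ r) (ω + ω') ^ (1 / r)) := by
  have hr0 : 0 < r := by linarith
  set K := hlMaximal (fun z => H z ^ r) (ω + ω') ^ (1 / r)
  have key : ∀ y, (∫⁻ x, H (x + y) * dualDensity r u ρ ω x) * dualDensity r u ρ ω' y ≤
      ballAverage r u ρ ω * (8 * K) * dualDensity r u ρ ω' y := by
    intro y
    by_cases hy : y ∈ Metric.ball ω' (ρ ω')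
    · gcongr
      refine (lintegral_mul_dualDensity_le hr hr2 hu ρ ω
        (hH.comp (measurable_add_const y))).trans ?_
      gcongr
      calc _ ≤ (8 * hlMaximal (fun z => H z ^ r) (ω + ω')) ^ (1 / r) := by
            gcongr
            exact setLAverage_ball_comp_add_le (fun z => H z ^ r) (hpos ω) h hy
        _ = 8 ^ (1 / r) * K := ENNReal.mul_rpow_of_nonneg _ _ (by positivity)
        -- As r ≥ 1, the factor 8^{1/r} may be replaced by 8, which keeps the constant free of r.
        _ ≤ 8 ^ (1 : ℝ) * K := by
            gcongr
            · norm_num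
            · rw [div_le_one hr0]; exact hr
        _ = 8 * K := by simp
    · simp [dualDensity, ballKernel, hy]
  have hJ : Measurable (dualDensity r u ρ ω') :=
    (measurable_const.mul (hu.enorm.pow_const _)).mul
      (measurable_const.indicator measurableSet_ball)
  calc _ ≤ ∫⁻ y, ballAverage r u ρ ω * (8 * K) * dualDensity r u ρ ω' y := lintegral_mono key
    _ = ballAverage r u ρ ω * (8 * K) * ∫⁻ y, dualDensity r u ρ ω' y := lintegral_const_mul _ hJ
    _ ≤ ballAverage r u ρ ω * (8 * K) * ballAverage r u ρ ω' := by
        gcongr; exact lintegral_dualDensity_le hr hr2 hu ρ ω'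
    _ = _ := by ring

theorem lintegral_lintegral_dualDensity_le {r : ℝ} (hr : 1 ≤ r) (hr2 : r < 2) {u : R3 → ℂ}
    (hu : Measurable u) {ρ : R3 → ℝ} (hpos : ∀ ω, 0 < ρ ω)
    {H : R3 → ℝ≥0∞} (hH : Measurable H) (ω ω' : R3) :
    ∫⁻ y, (∫⁻ x, H (x + y) * dualDensity r u ρ ω x) * dualDensity r u ρ ω' y ≤
      8 * (ballAverage r u ρ ω * ballAverage r u ρ ω' *
        hlMaximal (fun z => H z ^ r) (ω + ω') ^ (1 / r)) := by
  rcases le_total (ρ ω') (ρ ω) with h | h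
  · exact lintegral_lintegral_dualDensity_le_of_le hr hr2 hu hpos hH h
  · have := lintegral_lintegral_dualDensity_le_of_le hr hr2 hu hpos hH h
    rw [add_comm ω', mul_comm (ballAverage r u ρ ω')] at this
    refine le_trans (le_of_eq ?_) this
    have hJ : ∀ ω, Measurable (dualDensity r u ρ ω) := fun ω =>
      (measurable_const.mul (hu.enorm.pow_const _)).mul
        (measurable_const.indicator measurableSet_ball)
    have hm : ∀ y, Measurable fun x => H (x + y) := fun y => hH.comp (measurable_add_const y)
    have e : ∀ (ω ω' y : R3), (∫⁻ x, H (x + y) * dualDensity r u ρ ω x) *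
        dualDensity r u ρ ω' y =
        ∫⁻ x, H (x + y) * dualDensity r u ρ ω x * dualDensity r u ρ ω' y := fun ω ω' y =>
      (lintegral_mul_const _ ((hm y).mul (hJ ω))).symm
    simp_rw [e]
    rw [lintegral_lintegral_swap]
    · congr! 4 with x y
      rw [add_comm x y]; ring
    · have h1 := hJ ω
      have h2 := hJ ω'
      exact Measurable.aemeasurable (by fun_prop)

/-! ### Maximal restriction to measures whose self-convolution has a bounded density -/

/-- One of the two factors of the square is expanded as a convolution, and then z = x + y is
substituted. -/
theorem lintegral_lconvolution_sq {G : R3 → ℝ≥0∞} (hG : Measurable G) :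
    ∫⁻ z, lconvolution G G volume z ^ 2 =
      ∫⁻ y, (∫⁻ x, lconvolution G G volume (x + y) * G x) * G y := by
  set H := lconvolution G G volume with hH
  have hHm : Measurable H := measurable_lconvolution volume hG hG
  calc ∫⁻ z, H z ^ 2 = ∫⁻ z, ∫⁻ y, H z * (G y * G (-y + z)) := by
        congr! 2 with z
        rw [lintegral_const_mul _ (by fun_prop), sq]
        rfl
    _ = ∫⁻ y, ∫⁻ z, H z * (G y * G (-y + z)) :=
        lintegral_lintegral_swap (Measurable.aemeasurable (by fun_prop))
    _ = _ := by
        congr! 2 with y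
        rw [← lintegral_add_right_eq_self _ y, ← lintegral_mul_const _ (by fun_prop)]
        refine lintegral_congr fun x => ?_
        rw [show -y + (x + y) = x by abel]
        ring

theorem lintegral_lconvolution_eq_sq {G : R3 → ℝ≥0∞} (hG : Measurable G) :
    ∫⁻ z, lconvolution G G volume z = (∫⁻ x, G x) ^ 2 := by
  calc ∫⁻ z, lconvolution G G volume z = ∫⁻ y, ∫⁻ z, G y * G (-y + z) :=
        lintegral_lintegral_swap (Measurable.aemeasurable (by fun_prop))
    _ = ∫⁻ y, G y * ∫⁻ x, G x := by
        congr! 2 with y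
        rw [lintegral_const_mul _ (by fun_prop), lintegral_add_left_eq_self]
    _ = _ := by rw [lintegral_mul_const _ hG, sq]

/-- A qualitative statement: finiteness is what allows this quantity to be cancelled later, and no
constant depends on `b`. -/
theorem lintegral_lconvolution_sq_lt_top {G : R3 → ℝ≥0∞} (hG : Measurable G)
    (hint : ∫⁻ x, G x ≠ ∞) {b : ℝ≥0∞} (hb : b ≠ ∞) (hGb : ∀ x, G x ≤ b) :
    ∫⁻ z, lconvolution G G volume z ^ 2 < ∞ := by
  have h1 : ∀ z, lconvolution G G volume z ≤ (∫⁻ x, G x) * b := fun z => by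
    rw [← lintegral_mul_const _ hG, lconvolution_def]
    gcongr
    exact hGb _
  calc _ ≤ ∫⁻ z, lconvolution G G volume z * ((∫⁻ x, G x) * b) := by
        gcongr with z
        rw [sq]
        gcongr
        exact h1 z
    _ = (∫⁻ x, G x) ^ 2 * ((∫⁻ x, G x) * b) := by
        rw [lintegral_mul_const _ (measurable_lconvolution volume hG hG),
          lintegral_lconvolution_eq_sq hG]
    _ < ∞ := by
        rw [lt_top_iff_ne_top]
        exact ENNReal.mul_ne_top (ENNReal.pow_ne_top hint) (ENNReal.mul_ne_top hint hb)

/-- The convolution of `μ` with itself is at most `D` times the Lebesgue measure. -/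
def SelfConvolutionBound (μ : Measure R3) (D : ℝ≥0∞) : Prop :=
  ∀ k : R3 → ℝ≥0∞, Measurable k → ∫⁻ x, ∫⁻ y, k (x + y) ∂μ ∂μ ≤ D * ∫⁻ z, k z

/-- Cauchy–Schwarz on the product space. The factor with A(ω) A(ω') separates, and the other one is
the self-convolution of μ tested on k². -/
theorem SelfConvolutionBound.lintegral_mul_le {μ : Measure R3} [SFinite μ] {D : ℝ≥0∞}
    (h : SelfConvolutionBound μ D) {A k : R3 → ℝ≥0∞} (hA : Measurable A) (hk : Measurable k) :
    ∫⁻ ω', ∫⁻ ω, A ω * A ω' * k (ω + ω') ∂μ ∂μ ≤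
      (∫⁻ ω, A ω ^ 2 ∂μ) * (D * ∫⁻ z, k z ^ 2) ^ (1 / 2 : ℝ) := by
  have h1 : ∫⁻ ω', ∫⁻ ω, A ω * A ω' * k (ω + ω') ∂μ ∂μ =
      ∫⁻ z, ((A z.2 * A z.1) * k (z.2 + z.1)) ∂(μ.prod μ) :=
    (lintegral_prod (fun z : R3 × R3 => (A z.2 * A z.1) * k (z.2 + z.1))
      (Measurable.aemeasurable (by fun_prop))).symm
  rw [h1]
  refine (ENNReal.lintegral_mul_le_Lp_mul_Lq (μ.prod μ) Real.HolderConjugate.two_two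
    (f := fun z => A z.2 * A z.1) (g := fun z => k (z.2 + z.1))
    (Measurable.aemeasurable (by fun_prop)) (Measurable.aemeasurable (by fun_prop))).trans ?_
  gcongr ?_ * ?_ ^ (_ : ℝ)
  · rw [lintegral_prod _ (Measurable.aemeasurable (by fun_prop))]
    simp only [ENNReal.rpow_two, mul_pow]
    have : ∀ x, ∫⁻ y, A y ^ 2 * A x ^ 2 ∂μ = (∫⁻ y, A y ^ 2 ∂μ) * A x ^ 2 := fun x =>
      lintegral_mul_const _ (by fun_prop)
    simp_rw [this]
    rw [lintegral_const_mul _ (by fun_prop), ← sq, one_div, ← ENNReal.rpow_two,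
      ENNReal.rpow_rpow_inv (by norm_num)]
  · rw [lintegral_prod _ (Measurable.aemeasurable (by fun_prop))]
    simp only [ENNReal.rpow_two]
    refine le_trans (le_of_eq ?_) (h (fun z => k z ^ 2) (by fun_prop))
    refine lintegral_congr fun x => lintegral_congr fun y => ?_
    rw [add_comm]

theorem lintegral_lconvolution_sq_eq_of_density {μ : Measure R3} [SFinite μ]
    {J : R3 → R3 → ℝ≥0∞} (hJ : Measurable (Function.uncurry J)) {G : R3 → ℝ≥0∞}
    (hG : ∀ x, G x = ∫⁻ ω, J ω x ∂μ) :
    ∫⁻ z, lconvolution G G volume z ^ 2 = ∫⁻ ω', ∫⁻ ω, ∫⁻ y,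
      (∫⁻ x, lconvolution G G volume (x + y) * J ω x) * J ω' y ∂volume ∂μ ∂μ := by
  have hJ' : ∀ ω, Measurable (J ω) := fun ω => hJ.comp measurable_prodMk_left
  have hJ'' : ∀ x, Measurable fun ω => J ω x := fun x => hJ.comp measurable_prodMk_right
  have hGm : Measurable G := by
    rw [funext hG]
    exact hJ.lintegral_prod_left'
  have hHm : Measurable (lconvolution G G volume) := measurable_lconvolution volume hGm hGm
  rw [lintegral_lconvolution_sq hGm]
  generalize lconvolution G G volume = H at hHm ⊢
  obtain ⟨φ, hφ⟩ : ∃ φ : R3 → R3 → ℝ≥0∞, ∀ ω y, φ ω y = ∫⁻ x, H (x + y) * J ω x :=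
    ⟨_, fun _ _ => rfl⟩
  have hφm : Measurable (Function.uncurry φ) := by
    have : Measurable fun w : (R3 × R3) × R3 => H (w.2 + w.1.2) * J w.1.1 w.2 :=
      (hHm.comp (by fun_prop)).mul
        (hJ.comp (show Measurable fun w : (R3 × R3) × R3 => (w.1.1, w.2) by fun_prop))
    simpa only [Function.uncurry_def, hφ] using this.lintegral_prod_right'
  have hφ' : ∀ y, Measurable fun ω => φ ω y := fun y => hφm.comp measurable_prodMk_right
  have e1 : ∀ y, ∫⁻ x, H (x + y) * G x = ∫⁻ ω, φ ω y ∂μ := by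
    intro y
    simp_rw [hG, hφ]
    rw [lintegral_lintegral_swap]
    · exact lintegral_congr fun x => (lintegral_const_mul _ (hJ'' x)).symm
    · exact ((hHm.comp (by fun_prop)).mul hJ).aemeasurable
  simp_rw [← hφ, e1]
  calc ∫⁻ y, (∫⁻ ω, φ ω y ∂μ) * G y
      = ∫⁻ y, ∫⁻ ω', (∫⁻ ω, φ ω y ∂μ) * J ω' y ∂μ := by
        refine lintegral_congr fun y => ?_
        rw [hG, lintegral_const_mul _ (hJ'' y)]
    _ = ∫⁻ ω', ∫⁻ y, (∫⁻ ω, φ ω y ∂μ) * J ω' y ∂volume ∂μ := by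
        refine lintegral_lintegral_swap (Measurable.aemeasurable ?_)
        exact (hφm.lintegral_prod_left'.comp measurable_fst).mul (hJ.comp measurable_swap)
    _ = ∫⁻ ω', ∫⁻ y, ∫⁻ ω, φ ω y * J ω' y ∂μ ∂volume ∂μ :=
        lintegral_congr fun ω' => lintegral_congr fun y => (lintegral_mul_const _ (hφ' y)).symm
    _ = ∫⁻ ω', ∫⁻ ω, ∫⁻ y, φ ω y * J ω' y ∂volume ∂μ ∂μ := by
        refine lintegral_congr fun ω' => ?_
        refine lintegral_lintegral_swap (Measurable.aemeasurable ?_)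
        exact (hφm.comp measurable_swap).mul ((hJ' ω').comp measurable_fst)

/-- The strong type bound at exponent 2/r, applied to H^r. The condition r < 2 says exactly that
this exponent exceeds 1. -/
theorem lintegral_hlMaximal_rpow_sq_le {r : ℝ} (hr : 1 ≤ r) (hr2 : r < 2) {H : R3 → ℝ≥0∞}
    (hH : Measurable H) :
    ∫⁻ z, (hlMaximal (fun z => H z ^ r) z ^ (1 / r)) ^ 2 ≤
      ENNReal.ofReal (128 * (2 / r) * 2 ^ (2 / r - 1) / (2 / r - 1)) * ∫⁻ z, H z ^ 2 := by
  have hr0 : 0 < r := by linarith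
  have hq : 1 < 2 / r := by rwa [lt_div_iff₀ hr0, one_mul]
  have e2 : ∀ z, (hlMaximal (fun z => H z ^ r) z ^ (1 / r)) ^ 2 =
      hlMaximal (fun z => H z ^ r) z ^ (2 / r) := fun z => by
    rw [← ENNReal.rpow_two, ← ENNReal.rpow_mul]; ring_nf
  have e3 : ∀ z, H z ^ 2 = (H z ^ r) ^ (2 / r) := fun z => by
    rw [← ENNReal.rpow_two, ← ENNReal.rpow_mul, mul_div_cancel₀ _ hr0.ne']
  simp_rw [e2, e3]
  exact lintegral_hlMaximal_rpow_le hq (hH.pow_const r)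

/-- The constant in the maximal restriction estimate. -/
def restrictionConst (r : ℝ) (D : ℝ≥0∞) : ℝ≥0∞ :=
  8 * (D * ENNReal.ofReal (128 * (2 / r) * 2 ^ (2 / r - 1) / (2 / r - 1))) ^ (1 / 2 : ℝ)

theorem restrictionConst_ne_top (r : ℝ) {D : ℝ≥0∞} (hD : D ≠ ∞) : restrictionConst r D ≠ ∞ :=
  ENNReal.mul_ne_top (by norm_num) (ENNReal.rpow_ne_top_of_nonneg (by norm_num)
    (ENNReal.mul_ne_top hD (by simp)))

theorem lintegral_lconvolution_dualDensity_sq_le {μ : Measure R3} [SFinite μ] {D : ℝ≥0∞}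
    (hμ : SelfConvolutionBound μ D) {r : ℝ} (hr : 1 ≤ r) (hr2 : r < 2) {u : R3 → ℂ}
    (hu : Measurable u) {ρ : R3 → ℝ} (hρ : Measurable ρ) (hpos : ∀ ω, 0 < ρ ω)
    {G : R3 → ℝ≥0∞} (hG : ∀ x, G x = ∫⁻ ω, dualDensity r u ρ ω x ∂μ) :
    ∫⁻ z, lconvolution G G volume z ^ 2 ≤
      (∫⁻ ω, ballAverage r u ρ ω ^ 2 ∂μ) * restrictionConst r D *
        (∫⁻ z, lconvolution G G volume z ^ 2) ^ (1 / 2 : ℝ) := by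
  have hJ := measurable_dualDensity (r := r) hu hρ
  have hA := measurable_ballAverage (r := r) hu hρ
  have hGm : Measurable G := by
    rw [funext hG]
    exact hJ.lintegral_prod_left'
  have hHm : Measurable (lconvolution G G volume) := measurable_lconvolution volume hGm hGm
  have h1 := lintegral_lconvolution_sq_eq_of_density hJ hG
  refine h1.trans_le ?_
  clear h1
  generalize lconvolution G G volume = H at hHm ⊢
  obtain ⟨K, hK⟩ : ∃ K : R3 → ℝ≥0∞, ∀ z, K z = hlMaximal (fun z => H z ^ r) z ^ (1 / r) :=
    ⟨_, fun _ => rfl⟩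
  have hKm : Measurable K := by
    rw [funext hK]
    exact (measurable_hlMaximal _).pow_const _
  calc _ ≤ ∫⁻ ω', ∫⁻ ω, 8 * (ballAverage r u ρ ω * ballAverage r u ρ ω' * K (ω + ω')) ∂μ ∂μ := by
        refine lintegral_mono fun ω' => lintegral_mono fun ω => ?_
        simp_rw [hK]
        exact lintegral_lintegral_dualDensity_le hr hr2 hu hpos hHm ω ω'
    _ = 8 * ∫⁻ ω', ∫⁻ ω, ballAverage r u ρ ω * ballAverage r u ρ ω' * K (ω + ω') ∂μ ∂μ := by
        rw [← lintegral_const_mul' _ _ (by norm_num)]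
        exact lintegral_congr fun ω' => lintegral_const_mul' _ _ (by norm_num)
    _ ≤ 8 * ((∫⁻ ω, ballAverage r u ρ ω ^ 2 ∂μ) * (D * ∫⁻ z, K z ^ 2) ^ (1 / 2 : ℝ)) := by
        gcongr
        exact hμ.lintegral_mul_le hA hKm
    _ ≤ 8 * ((∫⁻ ω, ballAverage r u ρ ω ^ 2 ∂μ) *
        (D * (ENNReal.ofReal (128 * (2 / r) * 2 ^ (2 / r - 1) / (2 / r - 1)) *
          ∫⁻ z, H z ^ 2)) ^ (1 / 2 : ℝ)) := by
        gcongr 8 * (_ * (D * ?_) ^ (_ : ℝ))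
        simp_rw [hK]
        exact lintegral_hlMaximal_rpow_sq_le hr hr2 hHm
    _ = _ := by
        rw [← mul_assoc D, ENNReal.mul_rpow_of_nonneg _ _ (by norm_num), restrictionConst]
        ring

/-- Duality: a weight `G` bounds the pairing of a Fourier transform with any phase times `G`. -/
theorem lintegral_enorm_fourier_mul_le {f : R3 → ℂ} (hf : Integrable f) {G : R3 → ℝ≥0∞}
    (hG : Measurable G) (hGtop : ∀ x, G x ≠ ∞) (hGint : ∫⁻ x, G x ≠ ∞) :
    ∫⁻ x, ‖𝓕 f x‖ₑ * G x ≤ eLpNorm f (4 / 3) volume *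
      (∫⁻ z, lconvolution G G volume z ^ 2) ^ (1 / 4 : ℝ) := by
  have hu : Measurable (𝓕 f) := (continuous_fourier hf).measurable
  have huc : ∀ x, ‖𝓕 f x‖ₑ ≤ ∫⁻ x, ‖f x‖ₑ := enorm_fourier_le f
  have hStop : ∫⁻ x, ‖𝓕 f x‖ₑ * G x ≠ ∞ := by
    refine ne_top_of_le_ne_top (b := ∫⁻ x, (∫⁻ x, ‖f x‖ₑ) * G x) ?_ ?_
    · rw [lintegral_const_mul _ hG]
      exact ENNReal.mul_ne_top hf.2.ne hGint
    · gcongr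
      exact huc _
  generalize hudef : 𝓕 f = u at hu huc hStop ⊢
  obtain ⟨φ, hφ⟩ : ∃ φ : R3 → ℝ, ∀ x, φ x = (G x).toReal := ⟨_, fun _ => rfl⟩
  have hφ0 : ∀ x, 0 ≤ φ x := fun x => by rw [hφ]; exact ENNReal.toReal_nonneg
  have hφm : Measurable φ := by
    rw [funext hφ]
    exact hG.ennreal_toReal
  -- The conjugate phase makes u F = |u| G. Where u vanishes the quotient is 0 / 0 = 0, which is
  -- harmless there.
  obtain ⟨F, hF⟩ : ∃ F : R3 → ℂ, ∀ x, F x = (starRingEnd ℂ) (u x) / ‖u x‖ * φ x :=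
    ⟨_, fun _ => rfl⟩
  have hFm : Measurable F := by
    rw [funext hF]
    have h2 : Measurable fun x => (starRingEnd ℂ) (u x) :=
      continuous_star.measurable.comp hu
    fun_prop
  have hFG : ∀ x, ‖F x‖ₑ ≤ G x := by
    intro x
    have h1 : ‖F x‖ ≤ φ x := by
      simp only [hF, norm_mul, norm_div, Complex.norm_conj, Complex.norm_real, norm_norm]
      calc ‖u x‖ / ‖u x‖ * ‖φ x‖ ≤ 1 * ‖φ x‖ := by gcongr; exact div_self_le_one _
        _ = φ x := by rw [one_mul, Real.norm_of_nonneg (hφ0 x)]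
    rw [← ofReal_norm, ← ENNReal.ofReal_toReal (hGtop x), ← hφ]
    exact ENNReal.ofReal_le_ofReal h1
  have hFi : Integrable F := ⟨hFm.aestronglyMeasurable,
    (lintegral_mono hFG).trans_lt (lt_top_iff_ne_top.2 hGint)⟩
  have huF : ∀ x, u x * F x = ((‖u x‖ * φ x : ℝ) : ℂ) := by
    intro x
    by_cases h0 : u x = 0
    · simp [h0]
    have : (‖u x‖ : ℂ) ≠ 0 := by simpa using h0
    rw [hF, ← mul_assoc, ← mul_div_assoc, Complex.mul_conj, Complex.normSq_eq_norm_sq]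
    push_cast
    field_simp
  have e : ∀ x, ENNReal.ofReal (‖u x‖ * φ x) = ‖u x‖ₑ * G x := fun x => by
    rw [ENNReal.ofReal_mul (norm_nonneg _), ofReal_norm, hφ, ENNReal.ofReal_toReal (hGtop x)]
  have hnn : ∀ x, 0 ≤ ‖u x‖ * φ x := fun x => mul_nonneg (norm_nonneg _) (hφ0 x)
  have hpair : ‖∫ x, u x * F x‖ₑ = ∫⁻ x, ‖u x‖ₑ * G x := by
    simp_rw [huF]
    rw [integral_complex_ofReal, ← ofReal_norm, Complex.norm_real,
      Real.norm_of_nonneg (integral_nonneg hnn), ofReal_integral_eq_lintegral_ofReal]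
    · simp_rw [e]
    · refine ⟨(hu.norm.mul hφm).aestronglyMeasurable, ?_⟩
      refine lt_of_eq_of_lt ?_ (lt_top_iff_ne_top.2 hStop)
      refine lintegral_congr fun x => ?_
      rw [← e, Real.enorm_of_nonneg (hnn x)]
    · exact Filter.Eventually.of_forall hnn
  rw [← hpair, ← hudef]
  refine (enorm_integral_fourier_mul_le hf hFi).trans ?_
  gcongr with x
  rw [lconvolution_def, lconvolution_def]
  gcongr
  · exact hFG _
  · exact hFG _

/-- Cancelling X^{1/2} gives X^{1/2} ≤ S R, hence S² ≤ B² X^{1/2} ≤ B² S R, and S cancels. Both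
cancellations rely on finiteness. -/
theorem le_of_sq_le_mul_of_sq_le {S X B R : ℝ≥0∞} (hS : S ≠ ∞) (hX : X ≠ ∞)
    (h1 : X ≤ S * R * X ^ (1 / 2 : ℝ)) (h2 : S ≤ B * X ^ (1 / 4 : ℝ)) : S ≤ R * B ^ 2 := by
  have hXle : X ^ (1 / 2 : ℝ) ≤ S * R := by
    by_cases hX0 : X = 0
    · rw [hX0]; simp
    have h2 : X = X ^ (1 / 2 : ℝ) * X ^ (1 / 2 : ℝ) := by
      rw [← ENNReal.rpow_add _ _ hX0 hX]; norm_num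
    have h3 : X ^ (1 / 2 : ℝ) ≠ 0 := by simp [hX0]
    have h4 : X ^ (1 / 2 : ℝ) ≠ ∞ := ENNReal.rpow_ne_top_of_nonneg (by norm_num) hX
    nth_rw 1 [h2] at h1
    exact (ENNReal.mul_le_mul_iff_left h3 h4).1 h1
  by_cases hS0 : S = 0
  · rw [hS0]; exact zero_le
  refine (ENNReal.mul_le_mul_iff_left hS0 hS).1 ?_
  calc S * S = S ^ 2 := (sq S).symm
    _ ≤ (B * X ^ (1 / 4 : ℝ)) ^ 2 := by gcongr
    _ = B ^ 2 * X ^ (1 / 2 : ℝ) := by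
        rw [mul_pow, ← ENNReal.rpow_two (X ^ _), ← ENNReal.rpow_mul]; norm_num
    _ ≤ B ^ 2 * (S * R) := by gcongr
    _ = _ := by ring

/-- The positive lower bound `a` on the radii serves only to make G bounded, and so the quantities
to be cancelled finite. It does not enter the constant. -/
theorem lintegral_ballAverage_sq_le_of_radius {μ : Measure R3} [IsFiniteMeasure μ] {D : ℝ≥0∞}
    (hμ : SelfConvolutionBound μ D) {r : ℝ} (hr : 1 ≤ r) (hr2 : r < 2)
    {f : R3 → ℂ} (hf : Integrable f) {ρ : R3 → ℝ} (hρ : Measurable ρ) {a : ℝ} (ha : 0 < a)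
    (hρa : ∀ ω, a ≤ ρ ω) :
    ∫⁻ ω, ballAverage r (𝓕 f) ρ ω ^ 2 ∂μ ≤
      restrictionConst r D * eLpNorm f (4 / 3) volume ^ 2 := by
  have hr0 : 0 < r := by linarith
  have h2r : 0 ≤ 2 - r := by linarith
  have hr1 : 0 ≤ r - 1 := by linarith
  have hpos : ∀ ω, 0 < ρ ω := fun ω => ha.trans_le (hρa ω)
  have hu : Measurable (𝓕 f) := (continuous_fourier hf).measurable
  obtain ⟨c, hc, huc⟩ : ∃ c : ℝ≥0∞, c ≠ ∞ ∧ ∀ x, ‖𝓕 f x‖ₑ ≤ c :=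
    ⟨_, hf.2.ne, enorm_fourier_le f⟩
  have hJ := measurable_dualDensity (r := r) hu hρ
  have hJ'' : ∀ x, Measurable fun ω => dualDensity r (𝓕 f) ρ ω x := fun x =>
    hJ.of_uncurry_right
  obtain ⟨G, hGdef⟩ : ∃ G : R3 → ℝ≥0∞, ∀ x, G x = ∫⁻ ω, dualDensity r (𝓕 f) ρ ω x ∂μ :=
    ⟨_, fun _ => rfl⟩
  have hG : Measurable G := by
    rw [funext hGdef]
    exact hJ.lintegral_prod_left'
  have hAc : ∀ ω, ballAverage r (𝓕 f) ρ ω ≤ c := fun ω => ballAverage_le hr0 (hpos ω) huc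
  have hStop : ∫⁻ ω, ballAverage r (𝓕 f) ρ ω ^ 2 ∂μ ≠ ∞ := by
    refine ne_top_of_le_ne_top (b := ∫⁻ _, c ^ 2 ∂μ) ?_
      (lintegral_mono fun ω => pow_le_pow_left' (hAc ω) 2)
    rw [lintegral_const]
    exact ENNReal.mul_ne_top (ENNReal.pow_ne_top hc) (measure_ne_top _ _)
  have hGint : ∫⁻ x, G x ≠ ∞ := by
    refine ne_top_of_le_ne_top (b := ∫⁻ _, c ∂μ) ?_ ?_
    · rw [lintegral_const]
      exact ENNReal.mul_ne_top hc (measure_ne_top _ _)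
    · simp_rw [hGdef]
      rw [lintegral_lintegral_swap]
      · exact lintegral_mono fun ω => (lintegral_dualDensity_le hr hr2 hu ρ ω).trans (hAc ω)
      · exact (hJ.comp measurable_swap).aemeasurable
  obtain ⟨b, hb, hGb⟩ : ∃ b : ℝ≥0∞, b ≠ ∞ ∧ ∀ x, G x ≤ b := by
    refine ⟨c ^ (2 - r) * c ^ (r - 1) * (volume (Metric.ball (0 : R3) a))⁻¹ * μ univ, ?_, ?_⟩
    · exact ENNReal.mul_ne_top (ENNReal.mul_ne_top (ENNReal.mul_ne_top
        (ENNReal.rpow_ne_top_of_nonneg h2r hc) (ENNReal.rpow_ne_top_of_nonneg hr1 hc))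
        (ENNReal.inv_ne_top.2 (volume_ball_pos _ ha).ne')) (measure_ne_top _ _)
    · intro x
      rw [hGdef]
      refine (lintegral_mono fun ω => ?_).trans (lintegral_const _).le
      rw [dualDensity]
      refine mul_le_mul' (mul_le_mul' (ENNReal.rpow_le_rpow (hAc ω) h2r)
        (ENNReal.rpow_le_rpow (huc x) hr1)) ?_
      rw [ballKernel]
      refine (indicator_le_self _ _ x).trans ?_
      rw [Measure.addHaar_ball_center]
      exact ENNReal.inv_le_inv.2 (measure_mono (Metric.ball_subset_ball (hρa ω)))
  have hSeq : ∫⁻ x, ‖𝓕 f x‖ₑ * G x = ∫⁻ ω, ballAverage r (𝓕 f) ρ ω ^ 2 ∂μ := by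
    simp_rw [← lintegral_enorm_mul_dualDensity hr hr2 hu ρ]
    rw [lintegral_lintegral_swap]
    · refine lintegral_congr fun x => ?_
      rw [hGdef]
      exact (lintegral_const_mul _ (hJ'' x)).symm
    · exact ((hu.comp measurable_snd).enorm.mul hJ).aemeasurable
  have hdual := lintegral_enorm_fourier_mul_le hf hG
    (fun x => ne_top_of_le_ne_top hb (hGb x)) hGint
  rw [hSeq] at hdual
  exact le_of_sq_le_mul_of_sq_le hStop (lintegral_lconvolution_sq_lt_top hG hGint hb hGb).ne
    (lintegral_lconvolution_dualDensity_sq_le hμ hr hr2 hu hρ hpos hGdef) hdual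

/-- Finitely many radii can be replaced by a single measurable function. -/
theorem exists_measurable_radius {r : ℝ} {u : R3 → ℂ} (hu : Measurable u)
    {q : ℕ → ℝ} (hq : ∀ n, 0 < q n) (n : ℕ) :
    ∃ ρ : R3 → ℝ, Measurable ρ ∧ (∃ a : ℝ, 0 < a ∧ ∀ ω, a ≤ ρ ω) ∧
      ∀ ω, ∀ i ≤ n, ballAverage r u (fun _ => q i) ω ≤ ballAverage r u ρ ω := by
  induction n with
  | zero =>
    refine ⟨fun _ => q 0, measurable_const, ⟨q 0, hq 0, fun _ => le_rfl⟩, fun ω i hi => ?_⟩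
    rw [Nat.le_zero.1 hi]
  | succ n ih =>
    obtain ⟨ρ, hρ, ⟨a, ha, hρa⟩, hmax⟩ := ih
    let T : Set R3 := {ω | ballAverage r u ρ ω ≤ ballAverage r u (fun _ => q (n + 1)) ω}
    have hT : MeasurableSet T := measurableSet_le (measurable_ballAverage hu hρ)
      (measurable_ballAverage hu measurable_const)
    classical
    refine ⟨T.piecewise (fun _ => q (n + 1)) ρ, Measurable.piecewise hT measurable_const hρ,
      ⟨min a (q (n + 1)), lt_min ha (hq _), fun ω => ?_⟩, fun ω i hi => ?_⟩
    · by_cases h : ω ∈ T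
      · simp [h]
      · simp [h, hρa]
    · by_cases h : ω ∈ T
      · have e : ballAverage r u (T.piecewise (fun _ => q (n + 1)) ρ) ω =
            ballAverage r u (fun _ => q (n + 1)) ω := by
          simp [ballAverage, h]
        rw [e]
        rcases Nat.le_succ_iff.1 hi with h' | h'
        · exact (hmax ω i h').trans h
        · rw [h']
      · have e : ballAverage r u (T.piecewise (fun _ => q (n + 1)) ρ) ω =
            ballAverage r u ρ ω := by
          simp [ballAverage, h]
        rw [e]
        rcases Nat.le_succ_iff.1 hi with h' | h'
        · exact hmax ω i h'
        · rw [h']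
          exact (not_le.1 h).le

/-- Rational radii suffice. Finitely many of them are dominated by one measurable radius function
that is bounded below, and the bound does not see how many, so monotone convergence finishes. -/
theorem lintegral_rMaximal_fourier_sq_le {μ : Measure R3} [IsFiniteMeasure μ] {D : ℝ≥0∞}
    (hμ : SelfConvolutionBound μ D) {r : ℝ} (hr : 1 ≤ r) (hr2 : r < 2)
    {f : R3 → ℂ} (hf : Integrable f) :
    ∫⁻ ω, rMaximal r (𝓕 f) ω ^ 2 ∂μ ≤ restrictionConst r D * eLpNorm f (4 / 3) volume ^ 2 := by
  have hr0 : 0 < r := by linarith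
  have hu : Measurable (𝓕 f) := (continuous_fourier hf).measurable
  have : Nonempty {q : ℚ // 0 < q} := ⟨⟨1, one_pos⟩⟩
  obtain ⟨e, he⟩ := exists_surjective_nat {q : ℚ // 0 < q}
  set q : ℕ → ℝ := fun n => ((e n : ℚ) : ℝ) with hq
  have hqpos : ∀ n, 0 < q n := fun n => by
    simp only [hq]
    exact_mod_cast (e n).2
  choose ρ hρ hρa hmax using fun n => exists_measurable_radius (r := r) hu hqpos n
  have h1 : ∀ ω, rMaximal r (𝓕 f) ω =
      ⨆ n, partialSups (fun n => ballAverage r (𝓕 f) (fun _ => q n)) n ω := by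
    intro ω
    rw [rMaximal_eq_iSup_rat hr0, ← he.iSup_comp]
    have := congrFun (iSup_partialSups_eq (fun n => ballAverage r (𝓕 f) (fun _ => q n))) ω
    rw [iSup_apply, iSup_apply] at this
    exact this.symm
  have hmono : Monotone fun n => fun ω =>
      partialSups (fun n => ballAverage r (𝓕 f) (fun _ => q n)) n ω ^ 2 := by
    intro m n hmn ω
    have := (partialSups (fun n => ballAverage r (𝓕 f) (fun _ => q n))).monotone hmn ω
    exact pow_le_pow_left' this 2
  have hps : ∀ n, Measurable (partialSups (fun n => ballAverage r (𝓕 f) (fun _ => q n)) n) := by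
    intro n
    induction n with
    | zero => simpa using measurable_ballAverage hu measurable_const
    | succ n ih =>
      rw [partialSups_add_one]
      exact ih.sup (measurable_ballAverage hu measurable_const)
  have h2 : ∀ ω, rMaximal r (𝓕 f) ω ^ 2 =
      ⨆ n, partialSups (fun n => ballAverage r (𝓕 f) (fun _ => q n)) n ω ^ 2 := by
    intro ω
    rw [h1]
    have := (ENNReal.orderIsoRpow 2 (by norm_num)).map_iSup
      fun n => partialSups (fun n => ballAverage r (𝓕 f) (fun _ => q n)) n ω
    simpa only [ENNReal.orderIsoRpow_apply, ENNReal.rpow_two] using this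
  simp_rw [h2]
  rw [lintegral_iSup (fun n => (hps n).pow_const 2) hmono]
  refine iSup_le fun n => ?_
  obtain ⟨a, ha, hρa⟩ := hρa n
  refine le_trans (lintegral_mono fun ω => ?_)
    (lintegral_ballAverage_sq_le_of_radius hμ hr hr2 hf (hρ n) ha hρa)
  gcongr
  have : partialSups (fun n => ballAverage r (𝓕 f) (fun _ => q n)) n ≤
      ballAverage r (𝓕 f) (ρ n) :=
    partialSups_le _ _ _ fun i hi ω => hmax n ω i hi
  exact this ω

/-! ### Spherical shells -/

/-- The area is a difference of disc areas, linear in the squared radius, so A cancels. For A < 0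
the region lies in a disc of squared radius A + η ≤ η, or is empty. -/
theorem volume_annulus_le (A : ℝ) {η : ℝ} (hη : 0 < η) :
    volume {y : Fin 2 → ℝ | A < y 0 ^ 2 + y 1 ^ 2 ∧ y 0 ^ 2 + y 1 ^ 2 < A + η} ≤
      ENNReal.ofReal (Real.pi * η) := by
  have hnorm : ∀ y : EuclideanSpace ℝ (Fin 2), ‖y‖ ^ 2 = y 0 ^ 2 + y 1 ^ 2 := fun y => by
    rw [EuclideanSpace.real_norm_sq_eq]; simp
  have hm : MeasurableSet {y : Fin 2 → ℝ | A < y 0 ^ 2 + y 1 ^ 2 ∧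
      y 0 ^ 2 + y 1 ^ 2 < A + η} := by
    have h1 : MeasurableSet {y : Fin 2 → ℝ | A < y 0 ^ 2 + y 1 ^ 2} :=
      measurableSet_lt (by fun_prop) (by fun_prop)
    have h2 : MeasurableSet {y : Fin 2 → ℝ | y 0 ^ 2 + y 1 ^ 2 < A + η} :=
      measurableSet_lt (by fun_prop) (by fun_prop)
    exact h1.inter h2
  rw [← (PiLp.volume_preserving_ofLp (Fin 2)).measure_preimage hm.nullMeasurableSet]
  have hball : ∀ (B : ℝ), 0 ≤ B →
      volume (Metric.ball (0 : EuclideanSpace ℝ (Fin 2)) (√B)) = ENNReal.ofReal (Real.pi * B) := by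
    intro B hB
    rw [EuclideanSpace.volume_ball_fin_two, ← ENNReal.ofReal_pow (Real.sqrt_nonneg _),
      Real.sq_sqrt hB, ← ENNReal.ofReal_mul hB, mul_comm]
  rcases lt_or_ge A 0 with hA | hA
  · rcases lt_or_ge (A + η) 0 with h | h
    · refine (measure_mono (t := ∅) fun y hy => ?_).trans (by simp)
      have := hy.2
      nlinarith [sq_nonneg (y 0), sq_nonneg (y 1)]
    · refine (measure_mono (t := Metric.ball 0 (√(A + η))) fun y hy => ?_).trans ?_
      · rw [mem_ball_zero_iff, Real.lt_sqrt (norm_nonneg _), hnorm]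
        exact hy.2
      · rw [hball _ h]
        exact ENNReal.ofReal_le_ofReal (by nlinarith [Real.pi_pos])
  · refine (measure_mono (t := Metric.ball 0 (√(A + η)) \ Metric.ball 0 (√A))
      fun y hy => ?_).trans ?_
    · rw [mem_sdiff, mem_ball_zero_iff, mem_ball_zero_iff, Real.lt_sqrt (norm_nonneg _),
        Real.lt_sqrt (norm_nonneg _), hnorm, not_lt]
      exact ⟨hy.2, hy.1.le⟩
    · rw [measure_sdiff (Metric.ball_subset_ball (Real.sqrt_le_sqrt (by linarith)))
        measurableSet_ball.nullMeasurableSet measure_ball_lt_top.ne, hball _ (by linarith),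
        hball _ hA, ← ENNReal.ofReal_sub _ (by positivity)]
      exact ENNReal.ofReal_le_ofReal (by linarith)

/-- Archimedes' observation: each planar slice of the shell is an annulus of area at most πη,
whatever its height. -/
theorem volume_shell_slab_le (s δ : ℝ) {η : ℝ} (hη : 0 < η) :
    volume {x : R3 | (1 < ‖x‖ ^ 2 ∧ ‖x‖ ^ 2 < 1 + η) ∧ s < x 0 ∧ x 0 < s + δ} ≤
      ENNReal.ofReal (Real.pi * η) * ENNReal.ofReal δ := by
  let T : Set (ℝ × (Fin 2 → ℝ)) := {p | (1 - p.1 ^ 2 < p.2 0 ^ 2 + p.2 1 ^ 2 ∧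
    p.2 0 ^ 2 + p.2 1 ^ 2 < 1 - p.1 ^ 2 + η) ∧ s < p.1 ∧ p.1 < s + δ}
  have hT : MeasurableSet T := by
    have h1 : MeasurableSet {p : ℝ × (Fin 2 → ℝ) | 1 - p.1 ^ 2 < p.2 0 ^ 2 + p.2 1 ^ 2} :=
      measurableSet_lt (by fun_prop) (by fun_prop)
    have h2 : MeasurableSet {p : ℝ × (Fin 2 → ℝ) | p.2 0 ^ 2 + p.2 1 ^ 2 < 1 - p.1 ^ 2 + η} :=
      measurableSet_lt (by fun_prop) (by fun_prop)
    have h3 : MeasurableSet {p : ℝ × (Fin 2 → ℝ) | s < p.1} :=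
      measurableSet_lt (by fun_prop) (by fun_prop)
    have h4 : MeasurableSet {p : ℝ × (Fin 2 → ℝ) | p.1 < s + δ} :=
      measurableSet_lt (by fun_prop) (by fun_prop)
    exact (h1.inter h2).inter (h3.inter h4)
  have hmp := (volume_preserving_piFinSuccAbove (fun _ : Fin 3 => ℝ) 0).comp
    (PiLp.volume_preserving_ofLp (Fin 3))
  have hpre : {x : R3 | (1 < ‖x‖ ^ 2 ∧ ‖x‖ ^ 2 < 1 + η) ∧ s < x 0 ∧ x 0 < s + δ} =
      (MeasurableEquiv.piFinSuccAbove (fun _ : Fin 3 => ℝ) 0 ∘ WithLp.ofLp) ⁻¹' T := by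
    ext x
    have h0 : (MeasurableEquiv.piFinSuccAbove (fun _ : Fin 3 => ℝ) 0 (WithLp.ofLp x)).1 = x 0 := rfl
    have h1 : (MeasurableEquiv.piFinSuccAbove (fun _ : Fin 3 => ℝ) 0 (WithLp.ofLp x)).2 0 = x 1 :=
      rfl
    have h2 : (MeasurableEquiv.piFinSuccAbove (fun _ : Fin 3 => ℝ) 0 (WithLp.ofLp x)).2 1 = x 2 :=
      rfl
    simp only [mem_ofPred_eq, mem_preimage, Function.comp_apply, T, h0, h1, h2]
    rw [EuclideanSpace.real_norm_sq_eq, Fin.sum_univ_three]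
    constructor
    · rintro ⟨⟨a, b⟩, c⟩
      exact ⟨⟨by linarith, by linarith⟩, c⟩
    · rintro ⟨⟨a, b⟩, c⟩
      exact ⟨⟨by linarith, by linarith⟩, c⟩
  rw [hpre, hmp.measure_preimage hT.nullMeasurableSet]
  calc (volume : Measure (ℝ × (Fin 2 → ℝ))) T
      = ∫⁻ t, volume (Prod.mk t ⁻¹' T) := Measure.prod_apply hT
    _ ≤ ∫⁻ t, (Ioo s (s + δ)).indicator (fun _ => ENNReal.ofReal (Real.pi * η)) t := by
        refine lintegral_mono fun t => ?_
        by_cases ht : t ∈ Ioo s (s + δ)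
        · rw [indicator_of_mem ht]
          exact (measure_mono fun y hy => hy.1).trans (volume_annulus_le (1 - t ^ 2) hη)
        · rw [indicator_of_notMem ht, show Prod.mk t ⁻¹' T = ∅ from
            eq_empty_of_forall_notMem fun y hy => ht hy.2]
          simp
    _ = _ := by
        rw [lintegral_indicator measurableSet_Ioo, setLIntegral_const, Real.volume_Ioo]
        simp

/-- Since |x|² and |z - x|² differ by less than 3ε, so do 2⟨z, x⟩ and |z|². Hence x lies in a slab
orthogonal to z of width 3ε/|z| ≤ 3ε, and it remains to intersect a shell with a slab. -/
theorem volume_inter_shells_le {z : R3} (hz : 1 ≤ ‖z‖) {ε : ℝ} (hε : 0 < ε) (hε1 : ε ≤ 1) :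
    volume {x : R3 | (1 < ‖x‖ ∧ ‖x‖ < 1 + ε) ∧ 1 < ‖z - x‖ ∧ ‖z - x‖ < 1 + ε} ≤
      ENNReal.ofReal (9 * Real.pi * ε ^ 2) := by
  set e : R3 := EuclideanSpace.single 0 1 with he
  have hez : ‖z‖ = ‖‖z‖ • e‖ := by simp [he, norm_smul]
  -- A reflection turns z onto the first coordinate axis.
  obtain ⟨L, hL⟩ : ∃ L : R3 ≃ₗᵢ[ℝ] R3, L z = ‖z‖ • e := ⟨_, Submodule.reflection_sub hez⟩
  have hz0 : 0 < ‖z‖ := by linarith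
  -- For ε ≤ 1 one has (1 + ε)² ≤ 1 + 3ε.
  have hsq : ∀ t : ℝ, 1 < t → t < 1 + ε → 1 < t ^ 2 ∧ t ^ 2 < 1 + 3 * ε := fun t h1 h2 =>
    ⟨by nlinarith, by nlinarith⟩
  have hcoord : ∀ x : R3, ‖z‖ * (L x) 0 = inner ℝ z x := by
    intro x
    rw [← L.inner_map_map z x, hL, inner_smul_left, he, EuclideanSpace.inner_single_left]
    simp
  set T : Set R3 := {x : R3 | (1 < ‖x‖ ^ 2 ∧ ‖x‖ ^ 2 < 1 + 3 * ε) ∧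
    ‖z‖ / 2 - 3 * ε / 2 < x 0 ∧ x 0 < ‖z‖ / 2 - 3 * ε / 2 + 3 * ε} with hTdef
  have hTo : IsOpen T := by
    have h0 : Continuous fun x : R3 => x 0 := by fun_prop
    have h1 : Continuous fun x : R3 => ‖x‖ ^ 2 := by fun_prop
    exact ((isOpen_lt continuous_const h1).inter (isOpen_lt h1 continuous_const)).inter
      ((isOpen_lt continuous_const h0).inter (isOpen_lt h0 continuous_const))
  have hsub : {x : R3 | (1 < ‖x‖ ∧ ‖x‖ < 1 + ε) ∧ 1 < ‖z - x‖ ∧ ‖z - x‖ < 1 + ε} ⊆ L ⁻¹' T := by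
    rintro x ⟨⟨h1, h2⟩, h3, h4⟩
    obtain ⟨a1, a2⟩ := hsq _ h1 h2
    obtain ⟨b1, b2⟩ := hsq _ h3 h4
    have hin := norm_sub_sq_real z x
    rw [← hcoord x] at hin
    refine ⟨by rw [L.norm_map]; exact ⟨a1, a2⟩, ?_, ?_⟩
    · by_contra! hcon
      nlinarith [mul_le_mul_of_nonneg_left hcon hz0.le]
    · by_contra! hcon
      nlinarith [mul_le_mul_of_nonneg_left hcon hz0.le]
  calc _ ≤ volume (L ⁻¹' T) := measure_mono hsub
    _ = volume T := L.measurePreserving.measure_preimage hTo.measurableSet.nullMeasurableSet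
    _ ≤ ENNReal.ofReal (Real.pi * (3 * ε)) * ENNReal.ofReal (3 * ε) :=
        volume_shell_slab_le _ _ (by positivity)
    _ = _ := by
        rw [← ENNReal.ofReal_mul (by positivity)]
        congr 1
        ring

/-- The part of the shell of thickness `ε` outside of the unit sphere which lies above
height `1 / 2` in the direction `s` times the `i`-th basis vector. -/
def capShell (i : Fin 3) (s ε : ℝ) : Set R3 := {x | (1 < ‖x‖ ∧ ‖x‖ < 1 + ε) ∧ 1 / 2 < s * x i}

theorem isOpen_capShell (i : Fin 3) (s ε : ℝ) : IsOpen (capShell i s ε) := by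
  have h0 : Continuous fun x : R3 => s * x i := by fun_prop
  exact ((isOpen_lt continuous_const continuous_norm).inter
    (isOpen_lt continuous_norm continuous_const)).inter (isOpen_lt continuous_const h0)

/-- The normalised Lebesgue measure on a cap of a shell. -/
def capMeasure (i : Fin 3) (s ε : ℝ) : Measure R3 :=
  ENNReal.ofReal ε⁻¹ • volume.restrict (capShell i s ε)

instance (i : Fin 3) (s ε : ℝ) : IsFiniteMeasure (capMeasure i s ε) := by
  have h : IsFiniteMeasure (volume.restrict (capShell i s ε)) := by
    refine ⟨?_⟩
    rw [Measure.restrict_apply_univ]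
    refine (measure_mono (t := Metric.ball 0 (1 + ε)) fun x hx => ?_).trans_lt measure_ball_lt_top
    rw [mem_ball_zero_iff]
    exact hx.1.2
  unfold capMeasure
  exact Measure.smul_finite _ ENNReal.ofReal_ne_top

/-- After substituting z = x + y, the density of the self-convolution at z is the volume of X ∩ (z -
X). -/
theorem setLIntegral_setLIntegral_comp_add_le {X : Set R3} (hX : MeasurableSet X) {V : ℝ≥0∞}
    (hV : ∀ z, volume (X ∩ {x | z - x ∈ X}) ≤ V) {k : R3 → ℝ≥0∞} (hk : Measurable k) :
    ∫⁻ x in X, ∫⁻ y in X, k (x + y) ≤ V * ∫⁻ z, k z := by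
  obtain ⟨χ, hχ⟩ : ∃ χ : R3 → ℝ≥0∞, χ = X.indicator 1 := ⟨_, rfl⟩
  have hχm : Measurable χ := by
    rw [hχ]
    exact measurable_one.indicator hX
  have hset : ∀ F : R3 → ℝ≥0∞, ∫⁻ x in X, F x = ∫⁻ x, χ x * F x := fun F => by
    rw [← lintegral_indicator hX]
    refine lintegral_congr fun x => ?_
    by_cases h : x ∈ X <;> simp [hχ, h]
  have hvol : ∀ z, ∫⁻ x, χ x * χ (z - x) ≤ V := by
    intro z
    have hm : Measurable fun x : R3 => z - x := by fun_prop
    have hS : MeasurableSet (X ∩ {x | z - x ∈ X}) := hX.inter (hm hX)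
    refine le_trans (le_of_eq ?_) (hV z)
    rw [← lintegral_indicator_one hS]
    refine lintegral_congr fun x => ?_
    by_cases h1 : x ∈ X <;> by_cases h2 : z - x ∈ X <;> simp [hχ, h1, h2]
  have e1 : ∀ x, ∫⁻ y in X, k (x + y) = ∫⁻ z, χ (z - x) * k z := by
    intro x
    rw [hset, ← lintegral_add_left_eq_self (fun z => χ (z - x) * k z) x]
    refine lintegral_congr fun y => ?_
    rw [add_sub_cancel_left]
  simp_rw [e1, hset]
  calc ∫⁻ x, χ x * ∫⁻ z, χ (z - x) * k z
      = ∫⁻ x, ∫⁻ z, χ x * (χ (z - x) * k z) :=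
        lintegral_congr fun x => (lintegral_const_mul _ (by fun_prop)).symm
    _ = ∫⁻ z, ∫⁻ x, χ x * (χ (z - x) * k z) :=
        lintegral_lintegral_swap (Measurable.aemeasurable (by fun_prop))
    _ ≤ ∫⁻ z, V * k z := by
        refine lintegral_mono fun z => ?_
        simp_rw [← mul_assoc]
        rw [lintegral_mul_const _ (by fun_prop)]
        gcongr
        exact hvol z
    _ = _ := lintegral_const_mul _ hk

theorem volume_capShell_inter_le (i : Fin 3) {s : ℝ} (hs : |s| = 1) {ε : ℝ} (hε : 0 < ε)
    (hε1 : ε ≤ 1) (z : R3) :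
    volume (capShell i s ε ∩ {x | z - x ∈ capShell i s ε}) ≤
      ENNReal.ofReal (9 * Real.pi * ε ^ 2) := by
  rcases (capShell i s ε ∩ {x | z - x ∈ capShell i s ε}).eq_empty_or_nonempty with h | ⟨x, h1, h2⟩
  · simp [h]
  -- Both summands have height above 1/2 in the same direction. This keeps z away from the origin,
  -- the singularity of the self-convolution of the full sphere.
  have hz : 1 ≤ ‖z‖ := by
    have h3 : 1 / 2 < s * x i := h1.2
    have h4 : 1 / 2 < s * (z i - x i) := h2.2
    calc (1 : ℝ) ≤ s * z i := by linarith
      _ ≤ |s * z i| := le_abs_self _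
      _ = ‖z i‖ := by rw [abs_mul, hs, one_mul, Real.norm_eq_abs]
      _ ≤ ‖z‖ := PiLp.norm_apply_le z i
  refine (measure_mono ?_).trans (volume_inter_shells_le hz hε hε1)
  exact fun x hx => ⟨hx.1.1, hx.2.1⟩

theorem selfConvolutionBound_capMeasure (i : Fin 3) {s : ℝ} (hs : |s| = 1) {ε : ℝ} (hε : 0 < ε)
    (hε1 : ε ≤ 1) :
    SelfConvolutionBound (capMeasure i s ε) (ENNReal.ofReal (9 * Real.pi)) := by
  intro k hk
  have h := setLIntegral_setLIntegral_comp_add_le (isOpen_capShell i s ε).measurableSet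
    (volume_capShell_inter_le i hs hε hε1) hk
  simp only [capMeasure, lintegral_smul_measure, smul_eq_mul]
  rw [lintegral_const_mul' _ _ ENNReal.ofReal_ne_top]
  calc _ ≤ ENNReal.ofReal ε⁻¹ * (ENNReal.ofReal ε⁻¹ *
        (ENNReal.ofReal (9 * Real.pi * ε ^ 2) * ∫⁻ z, k z)) := by gcongr
    _ = _ := by
        rw [← mul_assoc, ← mul_assoc, ← ENNReal.ofReal_mul (by positivity),
          ← ENNReal.ofReal_mul (by positivity)]
        congr 2
        field_simp

/-! ### From shells to the sphere -/

theorem lintegral_eq_lintegral_sphere (F : R3 → ℝ≥0∞) (hF : Measurable F) :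
    ∫⁻ x, F x = ∫⁻ ω : S2, ∫⁻ t in Ioi (0 : ℝ), ENNReal.ofReal (t ^ 2) * F (t • (ω : R3))
      ∂volume ∂surfaceMeasure := by
  have hmp := (volume : Measure R3).measurePreserving_homeomorphUnitSphereProd
  calc ∫⁻ x, F x = ∫⁻ x : ↥({(0 : R3)}ᶜ : Set R3), F (x : R3) ∂((volume : Measure R3).comap Subtype.val) := by
        rw [lintegral_subtype_comap (measurableSet_singleton _).compl, restrict_compl_singleton]
    _ = ∫⁻ x : ↥({(0 : R3)}ᶜ : Set R3), (fun p : S2 × Ioi (0 : ℝ) => F (p.2.1 • (p.1 : R3)))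
          (homeomorphUnitSphereProd R3 x) ∂((volume : Measure R3).comap Subtype.val) := by
        refine lintegral_congr fun x => ?_
        have := congrArg Subtype.val ((homeomorphUnitSphereProd R3).symm_apply_apply x)
        rw [homeomorphUnitSphereProd_symm_apply_coe] at this
        simp only [this]
    _ = ∫⁻ p, F (p.2.1 • (p.1 : R3)) ∂((volume : Measure R3).toSphere.prod
          (.volumeIoiPow (Module.finrank ℝ R3 - 1))) :=
        hmp.lintegral_comp
          (show Measurable fun p : S2 × Ioi (0 : ℝ) => F (p.2.1 • (p.1 : R3)) by fun_prop)
    _ = _ := by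
        rw [lintegral_prod _ (Measurable.aemeasurable (by fun_prop))]
        refine lintegral_congr fun ω => ?_
        rw [Measure.volumeIoiPow, lintegral_withDensity_eq_lintegral_mul _ (by fun_prop)
          (by fun_prop), finrank_euclideanSpace_fin]
        exact lintegral_subtype_comap measurableSet_Ioi
          fun t : ℝ => ENNReal.ofReal (t ^ 2) * F (t • (ω : R3))

/-- The cap of the unit sphere above height `1 / 2` in a coordinate direction. -/
def sphereCap (i : Fin 3) (s : ℝ) : Set S2 := {ω | 1 / 2 < s * (ω : R3) i}

theorem measurableSet_sphereCap (i : Fin 3) (s : ℝ) : MeasurableSet (sphereCap i s) := by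
  have h0 : Continuous fun ω : S2 => s * (ω : R3) i := by fun_prop
  exact (isOpen_lt continuous_const h0).measurableSet

/-- If every coordinate had modulus at most 1/2, the squared norm would be at most 3/4. -/
theorem iUnion_sphereCap : ⋃ i, (sphereCap i 1 ∪ sphereCap i (-1)) = univ := by
  refine eq_univ_of_forall fun ω => ?_
  by_contra h
  simp only [sphereCap, mem_iUnion, mem_union, mem_ofPred_eq, not_exists, not_or, not_lt] at h
  have hω : ‖(ω : R3)‖ = 1 := by simp
  have h1 := EuclideanSpace.real_norm_sq_eq (ω : R3)
  rw [hω, Fin.sum_univ_three] at h1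
  have h2 : ∀ i, (ω : R3) i ^ 2 ≤ 1 / 4 := fun i => by nlinarith [(h i).1, (h i).2]
  linarith [h2 0, h2 1, h2 2]

open Filter in
-- By lower semicontinuity g(ω) is at most the lower limit of its radial averages over (1, 1 + ε).
-- Integrated over the cap, these averages are bounded by shell integrals, and Fatou's lemma
-- applies.
theorem setLIntegral_sphereCap_le {g : R3 → ℝ≥0∞} (hg : LowerSemicontinuous g) {B : ℝ≥0∞}
    (i : Fin 3) (s : ℝ)
    (hB : ∀ ε : ℝ, 0 < ε → ε ≤ 1 → ∫⁻ x, g x ∂(capMeasure i s ε) ≤ B) :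
    ∫⁻ ω in sphereCap i s, g (ω : R3) ∂surfaceMeasure ≤ B := by
  have hgm : Measurable g := hg.measurable
  have hQ := measurableSet_sphereCap i s
  set ε : ℕ → ℝ := fun n => 1 / ((n : ℝ) + 1) with hε
  have hεpos : ∀ n, 0 < ε n := fun n => by simp only [hε]; positivity
  have hε1 : ∀ n, ε n ≤ 1 := fun n => by
    simp only [hε]
    rw [div_le_one (by positivity)]
    linarith [(Nat.cast_nonneg n : (0 : ℝ) ≤ n)]
  have hε0 : Tendsto ε atTop (nhds 0) := tendsto_one_div_add_atTop_nhds_zero_nat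
  set Φ : ℕ → S2 → ℝ≥0∞ := fun n ω =>
    ENNReal.ofReal (ε n)⁻¹ * ∫⁻ t in Ioo (1 : ℝ) (1 + ε n), g (t • (ω : R3)) with hΦ
  have hΦm : ∀ n, Measurable (Φ n) := by
    intro n
    refine Measurable.const_mul ?_ _
    have : Measurable fun p : S2 × ℝ => g (p.2 • (p.1 : R3)) := by fun_prop
    exact this.lintegral_prod_right'
  have hlim : ∀ ω : S2, g ω ≤ liminf (fun n => Φ n ω) atTop := by
    intro ω
    refine le_of_forall_lt fun c hc => ?_
    obtain ⟨c', hc1, hc2⟩ := exists_between hc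
    refine hc1.trans_le (le_liminf_of_le (by isBoundedDefault) ?_)
    have hcont : Tendsto (fun t : ℝ => t • (ω : R3)) (nhds 1) (nhds ω) := by
      have : Continuous fun t : ℝ => t • (ω : R3) := by fun_prop
      simpa using this.tendsto 1
    obtain ⟨δ, hδ, hδ'⟩ := Metric.eventually_nhds_iff.1 (hcont.eventually (hg ω c' hc2))
    filter_upwards [hε0.eventually (gt_mem_nhds hδ)] with n hn
    calc c' = ENNReal.ofReal (ε n)⁻¹ * ∫⁻ t in Ioo (1 : ℝ) (1 + ε n), c' := by
          rw [setLIntegral_const, Real.volume_Ioo, add_sub_cancel_left, mul_left_comm,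
            ← ENNReal.ofReal_mul (by have := hεpos n; positivity),
            inv_mul_cancel₀ (hεpos n).ne']
          simp
      _ ≤ Φ n ω := by
          simp only [hΦ]
          gcongr ENNReal.ofReal (ε n)⁻¹ * ?_
          refine setLIntegral_mono' measurableSet_Ioo fun t ht => ?_
          refine (hδ' (y := t) ?_).le
          rw [Real.dist_eq, abs_of_pos (by linarith [ht.1])]
          linarith [ht.2]
  have hΦB : ∀ n, ∫⁻ ω in sphereCap i s, Φ n ω ∂surfaceMeasure ≤ B := by
    intro n
    refine le_trans ?_ (hB (ε n) (hεpos n) (hε1 n))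
    have hXm : MeasurableSet (capShell i s (ε n)) := (isOpen_capShell i s (ε n)).measurableSet
    rw [capMeasure, lintegral_smul_measure, smul_eq_mul, ← lintegral_indicator hXm,
      lintegral_eq_lintegral_sphere _ (hgm.indicator hXm)]
    simp only [hΦ]
    rw [lintegral_const_mul' _ _ ENNReal.ofReal_ne_top]
    gcongr ENNReal.ofReal (ε n)⁻¹ * ?_
    rw [← lintegral_indicator hQ]
    refine lintegral_mono fun ω => ?_
    by_cases hω : ω ∈ sphereCap i s
    · rw [indicator_of_mem hω]
      refine (setLIntegral_mono' measurableSet_Ioo fun t ht => ?_).trans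
        (lintegral_mono_set (fun t ht => lt_trans one_pos ht.1))
      have hnorm : ‖t • (ω : R3)‖ = t := by
        have hω1 : ‖(ω : R3)‖ = 1 := by simp
        rw [norm_smul, hω1, mul_one, Real.norm_of_nonneg (by linarith [ht.1])]
      have hmem : t • (ω : R3) ∈ capShell i s (ε n) := by
        refine ⟨by rw [hnorm]; exact ht, ?_⟩
        have h1 : 1 / 2 < s * (ω : R3) i := hω
        rw [PiLp.smul_apply, smul_eq_mul]
        nlinarith [ht.1]
      rw [indicator_of_mem hmem]
      -- The shells lie outside the unit sphere, so the polar Jacobian is at least 1 and can be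
      -- dropped.
      have : (1 : ℝ≥0∞) ≤ ENNReal.ofReal (t ^ 2) := by
        rw [ENNReal.one_le_ofReal]
        nlinarith [ht.1]
      exact le_mul_of_one_le_left zero_le this
    · rw [indicator_of_notMem hω]
      exact zero_le
  calc _ ≤ ∫⁻ ω in sphereCap i s, liminf (fun n => Φ n ω) atTop ∂surfaceMeasure :=
        lintegral_mono fun ω => hlim ω
    _ ≤ liminf (fun n => ∫⁻ ω in sphereCap i s, Φ n ω ∂surfaceMeasure) atTop :=
        lintegral_liminf_le hΦm
    _ ≤ B := liminf_le_of_le (by isBoundedDefault) fun b hb => by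
        obtain ⟨n, hn⟩ := hb.exists
        exact hn.trans (hΦB n)

theorem lintegral_sphere_le_of_capMeasure {g : R3 → ℝ≥0∞} (hg : LowerSemicontinuous g) {B : ℝ≥0∞}
    (hB : ∀ (i : Fin 3) (s ε : ℝ), |s| = 1 → 0 < ε → ε ≤ 1 → ∫⁻ x, g x ∂(capMeasure i s ε) ≤ B) :
    ∫⁻ ω : S2, g (ω : R3) ∂surfaceMeasure ≤ 6 * B := by
  rw [← setLIntegral_univ, ← iUnion_sphereCap]
  calc _ ≤ ∑' i : Fin 3, ∫⁻ ω in sphereCap i 1 ∪ sphereCap i (-1), g (ω : R3) ∂surfaceMeasure :=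
        lintegral_iUnion_le _ _
    _ ≤ ∑' i : Fin 3, (B + B) := by
        refine ENNReal.tsum_le_tsum fun i => (lintegral_union_le _ _ _).trans (add_le_add ?_ ?_)
        · exact setLIntegral_sphereCap_le hg i 1 fun ε h h1 => hB i 1 ε (by simp) h h1
        · exact setLIntegral_sphereCap_le hg i (-1) fun ε h h1 => hB i (-1) ε (by simp) h h1
    _ = 6 * B := by
        rw [tsum_fintype]
        simp
        ring

theorem lintegral_sphere_rMaximal_fourier_sq_le {r : ℝ} (hr : 1 ≤ r) (hr2 : r < 2)
    {f : R3 → ℂ} (hf : Integrable f) :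
    ∫⁻ ω : S2, rMaximal r (𝓕 f) (ω : R3) ^ 2 ∂surfaceMeasure ≤
      6 * (restrictionConst r (ENNReal.ofReal (9 * Real.pi)) *
        eLpNorm f (4 / 3) volume ^ 2) := by
  refine lintegral_sphere_le_of_capMeasure (g := fun x => rMaximal r (𝓕 f) x ^ 2) ?_
    fun i s ε hs hε hε1 => lintegral_rMaximal_fourier_sq_le
      (selfConvolutionBound_capMeasure i hs hε hε1) hr hr2 hf
  exact (ENNReal.continuous_pow 2).comp_lowerSemicontinuous
    (lowerSemicontinuous_rMaximal (by linarith) _) fun a b hab => pow_le_pow_left' hab 2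

/-! ### Truncations of functions in `L^p` -/

theorem lintegral_enorm_rpow_toReal {p : ℝ≥0∞} (hp0 : p ≠ 0) (hp : p ≠ ∞) (f : R3 → ℂ) :
    ∫⁻ x, ‖f x‖ₑ ^ p.toReal = eLpNorm f p volume ^ p.toReal := by
  rw [eLpNorm_eq_lintegral_rpow_enorm_toReal hp0 hp, ← ENNReal.rpow_mul,
    one_div_mul_cancel (ENNReal.toReal_pos hp0 hp).ne', ENNReal.rpow_one]

theorem lintegral_enorm_le_of_large {P : ℝ} (hP : 1 ≤ P) {a : ℝ≥0∞} (ha : a ≠ 0) (ha' : a ≠ ∞)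
    {f g : R3 → ℂ} (hg : ∀ x, g x = 0 ∨ g x = f x ∧ a ≤ ‖f x‖ₑ) :
    ∫⁻ x, ‖g x‖ₑ ≤ (∫⁻ x, ‖f x‖ₑ ^ P) * a ^ (1 - P) := by
  rw [← lintegral_mul_const' _ _ (ENNReal.rpow_ne_top_of_ne_zero ha ha')]
  refine lintegral_mono fun x => ?_
  rcases hg x with h | ⟨h, hx⟩
  · simp [h]
  have hx0 : ‖f x‖ₑ ≠ 0 := fun h0 => ha (le_antisymm (h0 ▸ hx) zero_le)
  have e : ‖f x‖ₑ = ‖f x‖ₑ ^ P * ‖f x‖ₑ ^ (1 - P) := by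
    rw [← ENNReal.rpow_add _ _ hx0 enorm_ne_top]
    simp
  rw [h]
  calc ‖f x‖ₑ = ‖f x‖ₑ ^ P * ‖f x‖ₑ ^ (1 - P) := e
    _ ≤ _ := by
      gcongr _ * ?_
      rw [show 1 - P = -(P - 1) by ring, ENNReal.rpow_neg, ENNReal.rpow_neg]
      exact ENNReal.inv_le_inv.2 (ENNReal.rpow_le_rpow hx (by linarith))

theorem lintegral_enorm_rpow_le_of_small {P Q : ℝ} (hP : 0 < P) (hPQ : P ≤ Q) {b : ℝ≥0∞}
    (hb : b ≠ ∞) {f g : R3 → ℂ} (hg : ∀ x, g x = 0 ∨ g x = f x ∧ ‖f x‖ₑ ≤ b) :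
    ∫⁻ x, ‖g x‖ₑ ^ Q ≤ (∫⁻ x, ‖f x‖ₑ ^ P) * b ^ (Q - P) := by
  have hQP : 0 ≤ Q - P := by linarith
  rw [← lintegral_mul_const' _ _ (ENNReal.rpow_ne_top_of_nonneg hQP hb)]
  refine lintegral_mono fun x => ?_
  rcases hg x with h | ⟨h, hx⟩
  · simp [h, show 0 < Q by linarith]
  rw [h]
  calc ‖f x‖ₑ ^ Q = ‖f x‖ₑ ^ P * ‖f x‖ₑ ^ (Q - P) := by
        rw [← ENNReal.rpow_add_of_nonneg _ _ hP.le hQP]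
        ring_nf
    _ ≤ _ := by gcongr

theorem eLpNorm_four_thirds_eq (f : R3 → ℂ) :
    eLpNorm f (4 / 3) volume = (∫⁻ x, ‖f x‖ₑ ^ (4 / 3 : ℝ)) ^ (3 / 4 : ℝ) := by
  rw [eLpNorm_eq_lintegral_rpow_enorm_toReal (by simp) (ENNReal.div_ne_top (by simp) (by simp))]
  have h43 : (4 / 3 : ℝ≥0∞).toReal = 4 / 3 := by simp
  rw [h43]
  norm_num

/-! ### Norms of maximal functions on the sphere -/

/-- The norm in `L²` of the sphere of the maximal function of `r`-averages. -/
def sphereNorm (r : ℝ) (u : R3 → ℂ) : ℝ≥0∞ :=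
  eLpNorm (fun ω : S2 => rMaximal r u (ω : R3)) 2 surfaceMeasure

theorem measurable_rMaximal_sphere (r : ℝ) (u : R3 → ℂ) :
    Measurable fun ω : S2 => rMaximal r u (ω : R3) :=
  (measurable_rMaximal r u).comp measurable_subtype_coe

theorem sphereNorm_sq (r : ℝ) (u : R3 → ℂ) :
    sphereNorm r u ^ 2 = ∫⁻ ω : S2, rMaximal r u (ω : R3) ^ 2 ∂surfaceMeasure := by
  rw [sphereNorm, eLpNorm_two_sq]
  simp

instance : IsFiniteMeasure surfaceMeasure := by
  unfold surfaceMeasure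
  infer_instance

theorem sphereNorm_le_of_sq_le {r : ℝ} {u : R3 → ℂ} {B : ℝ≥0∞}
    (h : ∫⁻ ω : S2, rMaximal r u (ω : R3) ^ 2 ∂surfaceMeasure ≤ B ^ 2) : sphereNorm r u ≤ B := by
  rw [← sphereNorm_sq] at h
  exact (ENNReal.pow_le_pow_left_iff two_ne_zero).1 h

theorem sphereNorm_add_le {r : ℝ} (hr : 1 ≤ r) {u v : R3 → ℂ} (hu : Measurable u)
    (hv : Measurable v) :
    sphereNorm r (fun y => u y + v y) ≤ sphereNorm r u + sphereNorm r v := by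
  refine le_trans (eLpNorm_mono_enorm fun ω => ?_)
    (eLpNorm_add_le (measurable_rMaximal_sphere r u).aestronglyMeasurable
      (measurable_rMaximal_sphere r v).aestronglyMeasurable (by norm_num))
  simpa using rMaximal_add_le hr hu hv ω

theorem sphereNorm_zero {r : ℝ} (hr : 0 < r) : sphereNorm r (fun _ => 0) = 0 := by
  simp [sphereNorm, rMaximal_zero hr]

theorem sphereNorm_sum_le {ι : Type*} {r : ℝ} (hr : 1 ≤ r) (s : Finset ι) {u : ι → R3 → ℂ}
    (hu : ∀ i, Measurable (u i)) :
    sphereNorm r (fun y => ∑ i ∈ s, u i y) ≤ ∑ i ∈ s, sphereNorm r (u i) := by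
  classical
  induction s using Finset.induction_on with
  | empty => simp [sphereNorm_zero (show 0 < r by linarith)]
  | insert a s ha ih =>
    simp only [Finset.sum_insert ha]
    exact (sphereNorm_add_le hr (hu a) (Finset.measurable_fun_sum s fun i _ => hu i)).trans
      (by gcongr)

open Filter in
theorem sphereNorm_le_of_tendsto_ae {r : ℝ} (hr : 0 < r) {u : ℕ → R3 → ℂ} {v : R3 → ℂ}
    (hu : ∀ n, Measurable (u n))
    (h : ∀ᵐ y ∂volume, Tendsto (fun n => u n y) atTop (nhds (v y))) {B : ℝ≥0∞}
    (hB : ∀ n, sphereNorm r (u n) ≤ B) : sphereNorm r v ≤ B := by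
  refine sphereNorm_le_of_sq_le ?_
  have h1 : ∀ x, rMaximal r v x ^ 2 ≤ liminf (fun n => rMaximal r (u n) x ^ 2) atTop := by
    intro x
    refine (pow_le_pow_left' (rMaximal_le_liminf hr hu h x) 2).trans (le_of_eq ?_)
    have := (ENNReal.orderIsoRpow 2 (by norm_num)).liminf_apply
      (f := atTop) (u := fun n => rMaximal r (u n) x)
    simpa only [ENNReal.orderIsoRpow_apply, ENNReal.rpow_two] using this
  calc _ ≤ ∫⁻ ω : S2, liminf (fun n => rMaximal r (u n) (ω : R3) ^ 2) atTop ∂surfaceMeasure :=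
        lintegral_mono fun ω => h1 ω
    _ ≤ liminf (fun n => ∫⁻ ω : S2, rMaximal r (u n) (ω : R3) ^ 2 ∂surfaceMeasure) atTop :=
        lintegral_liminf_le fun n => (measurable_rMaximal_sphere r (u n)).pow_const 2
    _ ≤ B ^ 2 := liminf_le_of_le (by isBoundedDefault) fun b hb => by
        obtain ⟨n, hn⟩ := hb.exists
        exact hn.trans (by rw [← sphereNorm_sq]; exact pow_le_pow_left' (hB n) 2)

/-- A Fourier integral is bounded by the `L^1` norm and the sphere has finite area. This endpoint
has no upper restriction on r and serves r = 2 as well. -/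
theorem exists_sphereNorm_fourier_le_one :
    ∃ C : ℝ≥0∞, C ≠ ∞ ∧ ∀ (r : ℝ), 0 < r → ∀ f : R3 → ℂ,
      sphereNorm r (𝓕 f) ≤ C * ∫⁻ x, ‖f x‖ₑ := by
  refine ⟨surfaceMeasure univ ^ (1 / 2 : ℝ), ENNReal.rpow_ne_top_of_nonneg (by norm_num)
    (measure_ne_top _ _), fun r hr f => sphereNorm_le_of_sq_le ?_⟩
  calc _ ≤ ∫⁻ _ : S2, (∫⁻ x, ‖f x‖ₑ) ^ 2 ∂surfaceMeasure :=
        lintegral_mono fun ω => pow_le_pow_left' (rMaximal_le_const hr (enorm_fourier_le f) _) 2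
    _ = _ := by
        rw [lintegral_const, mul_pow, ← ENNReal.rpow_two (_ ^ _), ← ENNReal.rpow_mul, mul_comm]
        norm_num

theorem exists_sphereNorm_fourier_le_four_thirds {r : ℝ} (hr : 1 ≤ r) (hr2 : r < 2) :
    ∃ C : ℝ≥0∞, C ≠ ∞ ∧ ∀ f : R3 → ℂ, Integrable f →
      sphereNorm r (𝓕 f) ≤ C * eLpNorm f (4 / 3) volume := by
  refine ⟨(6 * restrictionConst r (ENNReal.ofReal (9 * Real.pi))) ^ (1 / 2 : ℝ),
    ENNReal.rpow_ne_top_of_nonneg (by norm_num) (ENNReal.mul_ne_top (by norm_num)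
      (restrictionConst_ne_top r ENNReal.ofReal_ne_top)),
    fun f hf => sphereNorm_le_of_sq_le ?_⟩
  refine (lintegral_sphere_rMaximal_fourier_sq_le hr hr2 hf).trans (le_of_eq ?_)
  rw [mul_pow, ← ENNReal.rpow_two (_ ^ _), ← ENNReal.rpow_mul]
  norm_num [mul_assoc]

/-- Interpolation between the estimates at exponents `1` and `4 / 3` for quadratic averages. -/
theorem exists_sphereNorm_two_fourier_le {θ : ℝ} (hθ : 1 / 2 ≤ θ) (hθ1 : θ < 1) :
    ∃ C : ℝ≥0∞, C ≠ ∞ ∧ ∀ f : R3 → ℂ, Integrable f →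
      sphereNorm 2 (𝓕 f) ≤
        C * (eLpNorm f (4 / 3) volume ^ θ * (∫⁻ x, ‖f x‖ₑ) ^ (1 - θ)) := by
  -- The order 2θ lies in [1, 2), and 2θ / 2 = θ is the power with which M_{2θ} enters. Hölder
  -- against the constant 1 on the sphere then restores the square.
  obtain ⟨C, hC, h⟩ := exists_sphereNorm_fourier_le_four_thirds
    (r := 2 * θ) (by linarith) (by linarith)
  have hθ0 : 0 < θ := by linarith
  have h1θ : 0 ≤ 1 - θ := by linarith
  set V := surfaceMeasure univ with hV
  refine ⟨C ^ θ * V ^ ((1 - θ) / 2), ENNReal.mul_ne_top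
    (ENNReal.rpow_ne_top_of_nonneg hθ0.le hC)
    (ENNReal.rpow_ne_top_of_nonneg (by positivity) (measure_ne_top _ _)), fun f hf => ?_⟩
  set L := ∫⁻ x, ‖f x‖ₑ with hL
  have hLtop : L ≠ ∞ := hf.2.ne
  have hrs : 2 * θ / 2 = θ := by ring
  have hpt : ∀ x, rMaximal 2 (𝓕 f) x ^ 2 ≤
      (rMaximal (2 * θ) (𝓕 f) x ^ 2) ^ θ * 1 ^ (1 - θ) * (L ^ (1 - θ)) ^ 2 := by
    intro x
    have := rMaximal_le_rMaximal_rpow_mul (r := 2 * θ) (s := 2) (by linarith) (by linarith)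
      hLtop (enorm_fourier_le f) x
    rw [hrs] at this
    refine (pow_le_pow_left' this 2).trans (le_of_eq ?_)
    rw [mul_pow, ENNReal.one_rpow, mul_one, ← ENNReal.rpow_two, ← ENNReal.rpow_two,
      ← ENNReal.rpow_two, ← ENNReal.rpow_mul, ← ENNReal.rpow_mul, ← ENNReal.rpow_mul, mul_comm θ]
  have hm := measurable_rMaximal_sphere (2 * θ) (𝓕 f)
  refine sphereNorm_le_of_sq_le ?_
  calc ∫⁻ ω : S2, rMaximal 2 (𝓕 f) (ω : R3) ^ 2 ∂surfaceMeasure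
      ≤ ∫⁻ ω : S2, (rMaximal (2 * θ) (𝓕 f) (ω : R3) ^ 2) ^ θ * 1 ^ (1 - θ) * (L ^ (1 - θ)) ^ 2
          ∂surfaceMeasure := lintegral_mono fun ω => hpt ω
    _ = (∫⁻ ω : S2, (rMaximal (2 * θ) (𝓕 f) (ω : R3) ^ 2) ^ θ * 1 ^ (1 - θ) ∂surfaceMeasure) *
          (L ^ (1 - θ)) ^ 2 :=
        lintegral_mul_const' _ _ (ENNReal.pow_ne_top (ENNReal.rpow_ne_top_of_nonneg h1θ hLtop))
    _ ≤ ((sphereNorm (2 * θ) (𝓕 f) ^ 2) ^ θ * V ^ (1 - θ)) * (L ^ (1 - θ)) ^ 2 := by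
        gcongr
        refine (ENNReal.lintegral_mul_norm_pow_le (hm.pow_const 2).aemeasurable
          (g := fun _ => 1) aemeasurable_const hθ0.le h1θ (by ring)).trans (le_of_eq ?_)
        rw [sphereNorm_sq, lintegral_one]
    _ ≤ (((C * eLpNorm f (4 / 3) volume) ^ 2) ^ θ * V ^ (1 - θ)) * (L ^ (1 - θ)) ^ 2 := by
        gcongr
        exact h f hf
    _ = _ := by
        have e1 : ((C * eLpNorm f (4 / 3) volume) ^ 2) ^ θ =
            (C ^ θ) ^ 2 * (eLpNorm f (4 / 3) volume ^ θ) ^ 2 := by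
          rw [← mul_pow, ← ENNReal.mul_rpow_of_nonneg _ _ hθ0.le, ← ENNReal.rpow_two,
            ← ENNReal.rpow_two, ← ENNReal.rpow_mul, ← ENNReal.rpow_mul, mul_comm θ]
        have e2 : V ^ (1 - θ) = (V ^ ((1 - θ) / 2)) ^ 2 := by
          rw [← ENNReal.rpow_two, ← ENNReal.rpow_mul]
          ring_nf
        rw [e1, e2]
        ring

/-! ### Interpolation by decomposing `f` according to height -/

theorem one_le_toReal {p : ℝ≥0∞} (hp : 1 ≤ p) (hp' : p ≠ ∞) : 1 ≤ p.toReal := by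
  simpa using (ENNReal.toReal_le_toReal (by simp) hp').2 hp

theorem sphereNorm_fourier_eq_zero {r : ℝ} (hr : 0 < r) {f : R3 → ℂ} (hf : f =ᵐ[volume] 0) :
    sphereNorm r (𝓕 f) = 0 := by
  have : 𝓕 f = 0 := by
    funext ξ
    rw [Real.fourier_congr_ae hf]
    exact fourier_integral_zero ξ
  rw [this]
  exact sphereNorm_zero hr

theorem ENNReal.rpow_mul_rpow_one_sub {N : ℝ≥0∞} (h0 : N ≠ 0) (hN : N ≠ ∞) (P : ℝ) :
    N ^ P * N ^ (1 - P) = N := by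
  rw [← ENNReal.rpow_add _ _ h0 hN, add_sub_cancel, ENNReal.rpow_one]

/-- The part of a function in `L^p` above the height `‖f‖_p` has `L^1` norm at most `‖f‖_p`. -/
theorem lintegral_enorm_indicator_lt_le {p : ℝ≥0∞} (hp : 1 ≤ p) (hp' : p ≠ ∞) {f : R3 → ℂ}
    (h0 : eLpNorm f p volume ≠ 0) (hN : eLpNorm f p volume ≠ ∞) :
    ∫⁻ x, ‖{x | eLpNorm f p volume < ‖f x‖ₑ}.indicator f x‖ₑ ≤ eLpNorm f p volume := by
  have hp0 : p ≠ 0 := (zero_lt_one.trans_le hp).ne'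
  refine (lintegral_enorm_le_of_large (f := f) (one_le_toReal hp hp') h0 hN fun x => ?_).trans ?_
  · by_cases h : eLpNorm f p volume < ‖f x‖ₑ
    · exact Or.inr ⟨by simp [h], h.le⟩
    · exact Or.inl (by simp [h])
  · rw [lintegral_enorm_rpow_toReal hp0 hp', ENNReal.rpow_mul_rpow_one_sub h0 hN]

theorem measurableSet_lt_enorm {f : R3 → ℂ} (hf : Measurable f) (a : ℝ≥0∞) :
    MeasurableSet {x | a < ‖f x‖ₑ} := measurableSet_lt measurable_const hf.enorm

theorem measurableSet_enorm_le {f : R3 → ℂ} (hf : Measurable f) (a : ℝ≥0∞) :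
    MeasurableSet {x | ‖f x‖ₑ ≤ a} := measurableSet_le hf.enorm measurable_const

/-- Cut at height N = ‖f‖_p: the upper part has `L^1` norm at most N and the lower part has
`L^{4/3}` norm at most N, so the two endpoint bounds add up. -/
theorem exists_sphereNorm_fourier_le {r : ℝ} {p : ℝ≥0∞} (hr : 1 ≤ r) (hr2 : r < 2) (hp : 1 ≤ p)
    (hp4 : p ≤ 4 / 3) : ∃ C : ℝ≥0∞, C ≠ ∞ ∧ ∀ f : R3 → ℂ, Measurable f → Integrable f →
      MemLp f p volume → sphereNorm r (𝓕 f) ≤ C * eLpNorm f p volume := by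
  obtain ⟨C₁, hC₁, h₁⟩ := exists_sphereNorm_fourier_le_one
  obtain ⟨C₂, hC₂, h₂⟩ := exists_sphereNorm_fourier_le_four_thirds hr hr2
  have h43 : (4 / 3 : ℝ≥0∞) ≠ ∞ := ENNReal.div_ne_top (by simp) (by simp)
  have hp' : p ≠ ∞ := ne_top_of_le_ne_top h43 hp4
  have hp0 : p ≠ 0 := (zero_lt_one.trans_le hp).ne'
  have hr0 : 0 < r := by linarith
  have hP : 1 ≤ p.toReal := one_le_toReal hp hp'
  have hP4 : p.toReal ≤ 4 / 3 := by simpa using (ENNReal.toReal_le_toReal hp' h43).2 hp4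
  refine ⟨C₁ + C₂, ENNReal.add_ne_top.2 ⟨hC₁, hC₂⟩, fun f hfm hfi hf => ?_⟩
  set N := eLpNorm f p volume with hNdef
  have hN : N ≠ ∞ := hf.2.ne
  by_cases h0 : N = 0
  · rw [sphereNorm_fourier_eq_zero hr0 ((eLpNorm_eq_zero_iff hf.1 hp0).1 h0)]
    exact zero_le
  set g := {x | N < ‖f x‖ₑ}.indicator f with hg
  set h := {x | ‖f x‖ₑ ≤ N}.indicator f with hh
  have hgi : Integrable g := hfi.indicator (measurableSet_lt_enorm hfm N)
  have hhi : Integrable h := hfi.indicator (measurableSet_enorm_le hfm N)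
  have hsplit : 𝓕 f = fun ξ => 𝓕 g ξ + 𝓕 h ξ := by
    funext ξ
    rw [← fourier_integral_add hgi hhi]
    refine congrArg (fun u : R3 → ℂ => 𝓕 u ξ) (funext fun x => ?_)
    by_cases hx : N < ‖f x‖ₑ
    · simp [hg, hh, hx, not_le.2 hx]
    · simp [hg, hh, hx, not_lt.1 hx]
  have hg1 : ∫⁻ x, ‖g x‖ₑ ≤ N := lintegral_enorm_indicator_lt_le hp hp' h0 hN
  have hh1 : eLpNorm h (4 / 3) volume ≤ N := by
    rw [eLpNorm_four_thirds_eq]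
    calc (∫⁻ x, ‖h x‖ₑ ^ (4 / 3 : ℝ)) ^ (3 / 4 : ℝ)
        ≤ (N ^ p.toReal * N ^ (4 / 3 - p.toReal)) ^ (3 / 4 : ℝ) := by
          gcongr
          rw [hNdef, ← lintegral_enorm_rpow_toReal hp0 hp', ← hNdef]
          refine lintegral_enorm_rpow_le_of_small (by linarith) hP4 hN fun x => ?_
          by_cases hx : ‖f x‖ₑ ≤ N
          · exact Or.inr ⟨by simp [hh, hx], hx⟩
          · exact Or.inl (by simp [hh, hx])
      _ = N := by
          rw [← ENNReal.rpow_add _ _ h0 hN, ← ENNReal.rpow_mul]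
          norm_num
  rw [hsplit]
  refine (sphereNorm_add_le hr (continuous_fourier hgi).measurable
    (continuous_fourier hhi).measurable).trans ?_
  rw [add_mul]
  gcongr
  · exact (h₁ r hr0 g).trans (by gcongr)
  · exact (h₂ h hhi).trans (by gcongr)

/-- The product of the bounds for a layer between the heights `2 ^ (-k - 1) N` and `2 ^ (-k) N`. -/
theorem layer_rpow_mul_rpow_eq {P : ℝ} {N : ℝ≥0∞} (h0 : N ≠ 0) (hN : N ≠ ∞) (hP : 0 ≤ P) (hP4 : P ≤ 4 / 3)
    (k : ℕ) :
    ((N ^ P * (N * (2⁻¹ : ℝ≥0∞) ^ k) ^ (4 / 3 - P)) ^ (3 / 4 : ℝ)) ^ (3 / 4 * P) *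
      (N ^ P * (N * (2⁻¹ : ℝ≥0∞) ^ (k + 1)) ^ (1 - P)) ^ (1 - 3 / 4 * P) =
    N * (((2⁻¹ : ℝ≥0∞) ^ ((1 - 3 / 4 * P) * (1 - P / 4))) ^ k *
      (2⁻¹ : ℝ≥0∞) ^ ((1 - P) * (1 - 3 / 4 * P))) := by
  have hx0 : (2⁻¹ : ℝ≥0∞) ≠ 0 := by simp
  have hx : (2⁻¹ : ℝ≥0∞) ≠ ∞ := by simp
  generalize (2⁻¹ : ℝ≥0∞) = x at *
  have hpow : ∀ (k : ℕ) (z : ℝ), (x ^ k) ^ z = x ^ (k * z) := fun k z => by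
    rw [← ENNReal.rpow_natCast, ← ENNReal.rpow_mul]
  have e1 : ∀ (k : ℕ) (z : ℝ), N ^ P * (N * x ^ k) ^ (z - P) = N ^ z * x ^ (k * (z - P)) := by
    intro k z
    rw [ENNReal.mul_rpow_of_ne_zero h0 (pow_ne_zero _ hx0), ← mul_assoc,
      ← ENNReal.rpow_add _ _ h0 hN, hpow, add_sub_cancel]
  rw [e1, e1, ← ENNReal.rpow_mul]
  rw [ENNReal.mul_rpow_of_nonneg _ _ (by positivity),
    ENNReal.mul_rpow_of_nonneg _ _ (by linarith), ← ENNReal.rpow_mul, ← ENNReal.rpow_mul,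
    ← ENNReal.rpow_mul, ← ENNReal.rpow_mul, mul_mul_mul_comm, ← ENNReal.rpow_add _ _ h0 hN,
    ← ENNReal.rpow_add _ _ hx0 hx, ← ENNReal.rpow_mul_natCast, ← ENNReal.rpow_add _ _ hx0 hx]
  have a1 : (4 / 3 : ℝ) * (3 / 4 * (3 / 4 * P)) + 1 * (1 - 3 / 4 * P) = 1 := by ring
  rw [a1, ENNReal.rpow_one]
  congr 2
  push_cast
  ring

/-- The part above N = ‖f‖_p is controlled in `L^1`. Below N the product bound on the layer at
height 2^{-k} N gains a factor q^k with q < 1. The lower bound η makes the decomposition finite, but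
the constant does not depend on it. -/
theorem exists_sphereNorm_two_fourier_le_of_lt {p : ℝ≥0∞} (hp : 1 ≤ p)
    (hp4 : p < 4 / 3) : ∃ C : ℝ≥0∞, C ≠ ∞ ∧ ∀ f : R3 → ℂ, Measurable f → Integrable f →
      MemLp f p volume → (∃ η : ℝ≥0∞, η ≠ 0 ∧ ∀ x, f x = 0 ∨ η ≤ ‖f x‖ₑ) →
      sphereNorm 2 (𝓕 f) ≤ C * eLpNorm f p volume := by
  have h43 : (4 / 3 : ℝ≥0∞) ≠ ∞ := ENNReal.div_ne_top (by simp) (by simp)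
  have hp' : p ≠ ∞ := hp4.ne_top
  have hp0 : p ≠ 0 := (zero_lt_one.trans_le hp).ne'
  have hP : 1 ≤ p.toReal := one_le_toReal hp hp'
  have hP4 : p.toReal < 4 / 3 := by simpa using (ENNReal.toReal_lt_toReal hp' h43).2 hp4
  obtain ⟨C₁, hC₁, h₁⟩ := exists_sphereNorm_fourier_le_one
  -- Exact scaling would be θ = 4(1 - 1/P). The larger θ = 3P/4 < 1 tilts the bound towards
  -- `L^{4/3}`, giving the decay exponent (1 - 3P/4)(1 - P/4) > 0 as the heights decrease.
  obtain ⟨C₂, hC₂, h₂⟩ := exists_sphereNorm_two_fourier_le (θ := 3 / 4 * p.toReal)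
    (by linarith) (by linarith)
  set P := p.toReal with hPdef
  set q : ℝ≥0∞ := (2⁻¹ : ℝ≥0∞) ^ ((1 - 3 / 4 * P) * (1 - P / 4)) with hq
  set D : ℝ≥0∞ := (2⁻¹ : ℝ≥0∞) ^ ((1 - P) * (1 - 3 / 4 * P)) with hD
  have hq1 : q < 1 := ENNReal.rpow_lt_one (by simp [ENNReal.inv_lt_one])
    (mul_pos (by linarith) (by linarith))
  refine ⟨C₁ + C₂ * ((1 - q)⁻¹ * D), ENNReal.add_ne_top.2 ⟨hC₁, ENNReal.mul_ne_top hC₂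
    (ENNReal.mul_ne_top (ENNReal.inv_ne_top.2 (tsub_pos_of_lt hq1).ne')
      (ENNReal.rpow_ne_top_of_ne_zero (by simp) (by simp)))⟩, ?_⟩
  rintro f hfm hfi hf ⟨η, hη, hfη⟩
  set N := eLpNorm f p volume with hNdef
  have hN : N ≠ ∞ := hf.2.ne
  by_cases h0 : N = 0
  · rw [sphereNorm_fourier_eq_zero two_pos ((eLpNorm_eq_zero_iff hf.1 hp0).1 h0)]
    exact zero_le
  set b : ℕ → ℝ≥0∞ := fun k => N * 2⁻¹ ^ k with hb
  have hb_succ : ∀ k, b (k + 1) ≤ b k := fun k => by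
    simp only [hb]
    gcongr N * ?_
    exact pow_le_pow_right_of_le_one' (by simp) (Nat.le_succ k)
  have hb0 : ∀ k, b k ≠ 0 := fun k => mul_ne_zero h0 (pow_ne_zero _ (by simp))
  have hbtop : ∀ k, b k ≠ ∞ := fun k => ENNReal.mul_ne_top hN (ENNReal.pow_ne_top (by simp))
  obtain ⟨K, hK⟩ : ∃ K, b K < η := by
    have := ENNReal.Tendsto.const_mul (a := N)
      (ENNReal.tendsto_pow_atTop_nhds_zero_of_lt_one (r := 2⁻¹) (by simp [ENNReal.inv_lt_one]))
      (Or.inr hN)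
    rw [mul_zero] at this
    exact (this.eventually_lt_const (pos_iff_ne_zero.2 hη)).exists
  set g := {x | N < ‖f x‖ₑ}.indicator f with hg
  set t : ℕ → R3 → ℂ := fun k => {x | ‖f x‖ₑ ≤ b k}.indicator f with ht
  set h : ℕ → R3 → ℂ := fun k x => t k x - t (k + 1) x with hh
  have hgi : Integrable g := hfi.indicator (measurableSet_lt_enorm hfm N)
  have hti : ∀ k, Integrable (t k) := fun k => hfi.indicator (measurableSet_enorm_le hfm _)
  have hhi : ∀ k, Integrable (h k) := fun k => (hti k).sub (hti (k + 1))
  have hlayer : ∀ k x, h k x = 0 ∨ h k x = f x ∧ b (k + 1) ≤ ‖f x‖ₑ ∧ ‖f x‖ₑ ≤ b k := by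
    intro k x
    by_cases h1 : ‖f x‖ₑ ≤ b (k + 1)
    · exact Or.inl (by simp [hh, ht, h1, h1.trans (hb_succ k)])
    by_cases h2 : ‖f x‖ₑ ≤ b k
    · exact Or.inr ⟨by simp [hh, ht, h1, h2], (not_le.1 h1).le, h2⟩
    · exact Or.inl (by simp [hh, ht, h1, h2])
  have htK : ∀ x, t K x = 0 := by
    intro x
    rcases hfη x with hx | hx
    · simp [ht, hx]
    · simp [ht, not_le.2 (hK.trans_le hx)]
  have hsplit : 𝓕 f = fun ξ => 𝓕 g ξ + ∑ k ∈ Finset.range K, 𝓕 (h k) ξ := by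
    funext ξ
    rw [← fourier_integral_sum _ hhi,
      ← fourier_integral_add hgi (integrable_finsetSum _ fun k _ => hhi k)]
    refine congrArg (fun u : R3 → ℂ => 𝓕 u ξ) (funext fun x => ?_)
    simp only [hh]
    rw [Finset.sum_range_sub', htK, sub_zero]
    by_cases hx : N < ‖f x‖ₑ
    · simp [hg, ht, hb, hx, not_le.2 hx]
    · simp [hg, ht, hb, hx, not_lt.1 hx]
  have hg1 : ∫⁻ x, ‖g x‖ₑ ≤ N := lintegral_enorm_indicator_lt_le hp hp' h0 hN
  have hI : ∫⁻ x, ‖f x‖ₑ ^ P = N ^ P := lintegral_enorm_rpow_toReal hp0 hp' f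
  have hk : ∀ k, sphereNorm 2 (𝓕 (h k)) ≤ C₂ * (N * (q ^ k * D)) := by
    intro k
    refine (h₂ (h k) (hhi k)).trans ?_
    rw [← layer_rpow_mul_rpow_eq h0 hN (by linarith) hP4.le k, eLpNorm_four_thirds_eq, ← hI]
    gcongr
    · refine lintegral_enorm_rpow_le_of_small (by linarith) hP4.le (hbtop k) fun x => ?_
      exact (hlayer k x).imp id fun h => ⟨h.1, h.2.2⟩
    · linarith
    · refine lintegral_enorm_le_of_large hP (hb0 (k + 1)) (hbtop (k + 1)) fun x => ?_
      exact (hlayer k x).imp id fun h => ⟨h.1, h.2.1⟩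
  rw [hsplit]
  have hhm : ∀ k, Measurable (𝓕 (h k)) := fun k => (continuous_fourier (hhi k)).measurable
  refine (sphereNorm_add_le one_le_two (continuous_fourier hgi).measurable
    (Finset.measurable_fun_sum _ fun k _ => hhm k)).trans ?_
  rw [add_mul]
  gcongr
  · exact (h₁ 2 two_pos g).trans (by gcongr)
  · calc _ ≤ ∑ k ∈ Finset.range K, sphereNorm 2 (𝓕 (h k)) :=
          sphereNorm_sum_le one_le_two _ hhm
      _ ≤ ∑ k ∈ Finset.range K, C₂ * (N * (q ^ k * D)) := Finset.sum_le_sum fun k _ => hk k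
      _ ≤ ∑' k, C₂ * (N * (q ^ k * D)) := ENNReal.sum_le_tsum _
      _ = C₂ * ((1 - q)⁻¹ * D) * N := by
          rw [ENNReal.tsum_mul_left, ENNReal.tsum_mul_left, ENNReal.tsum_mul_right,
            ENNReal.tsum_geometric]
          ring

/-! ### Approximation of the Fourier transform on `L^p` by Fourier integrals -/

theorem integrable_of_large {p : ℝ≥0∞} (hp : 1 ≤ p) (hp' : p ≠ ∞) {f g : R3 → ℂ}
    (hf : MemLp f p volume) (hg : Measurable g) {a : ℝ≥0∞} (ha : a ≠ 0) (ha' : a ≠ ∞)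
    (h : ∀ x, g x = 0 ∨ g x = f x ∧ a ≤ ‖f x‖ₑ) : Integrable g := by
  refine ⟨hg.aestronglyMeasurable, ?_⟩
  have hp0 : p ≠ 0 := (zero_lt_one.trans_le hp).ne'
  refine (lintegral_enorm_le_of_large (one_le_toReal hp hp') ha ha' h).trans_lt ?_
  rw [lintegral_enorm_rpow_toReal hp0 hp']
  exact ENNReal.mul_lt_top
    (ENNReal.rpow_lt_top_of_nonneg ENNReal.toReal_nonneg hf.2.ne)
    (ENNReal.rpow_ne_top_of_ne_zero ha ha').lt_top

open Filter in
-- Where |f| ≤ a one has |f|² ≤ |f|^p a^{2-p}, and p < 2.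
theorem tendsto_eLpNorm_two_of_small {p : ℝ≥0∞} (hp : 1 ≤ p) (hp2 : p < 2) {f : R3 → ℂ}
    (hf : MemLp f p volume) {a : ℕ → ℝ≥0∞} (ha : Tendsto a atTop (nhds 0))
    (ha' : ∀ n, a n ≠ ∞) {d : ℕ → R3 → ℂ}
    (hd : ∀ n x, d n x = 0 ∨ d n x = f x ∧ ‖f x‖ₑ ≤ a n) :
    Tendsto (fun n => eLpNorm (d n) 2 volume) atTop (nhds 0) := by
  have hp' : p ≠ ∞ := hp2.ne_top
  have hp0 : p ≠ 0 := (zero_lt_one.trans_le hp).ne'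
  have hP : 1 ≤ p.toReal := one_le_toReal hp hp'
  have hP2 : p.toReal < 2 := by simpa using (ENNReal.toReal_lt_toReal hp' (by simp)).2 hp2
  have hI : ∫⁻ x, ‖f x‖ₑ ^ p.toReal ≠ ∞ := by
    rw [lintegral_enorm_rpow_toReal hp0 hp']
    exact ENNReal.rpow_ne_top_of_nonneg ENNReal.toReal_nonneg hf.2.ne
  have hlim : Tendsto (fun n => ((∫⁻ x, ‖f x‖ₑ ^ p.toReal) * a n ^ (2 - p.toReal)) ^ (1 / 2 : ℝ))
      atTop (nhds 0) := by
    have h1 := (ENNReal.continuous_rpow_const (y := 2 - p.toReal)).continuousAt.tendsto.comp ha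
    rw [ENNReal.zero_rpow_of_pos (by linarith)] at h1
    have h2 := ENNReal.Tendsto.const_mul (a := ∫⁻ x, ‖f x‖ₑ ^ p.toReal) h1 (Or.inr hI)
    rw [mul_zero] at h2
    have h3 := (ENNReal.continuous_rpow_const (y := (1 / 2 : ℝ))).continuousAt.tendsto.comp h2
    rwa [ENNReal.zero_rpow_of_pos (by norm_num)] at h3
  refine tendsto_of_tendsto_of_tendsto_of_le_of_le tendsto_const_nhds hlim
    (fun _ => zero_le) fun n => ?_
  simp only
  rw [eLpNorm_eq_lintegral_rpow_enorm_toReal (by simp) (by simp), ENNReal.toReal_ofNat]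
  gcongr
  exact lintegral_enorm_rpow_le_of_small (by linarith) hP2.le (ha' n) (hd n)

open Filter in
/-- The Fourier transform of a function in `L^p` is the almost everywhere limit of Fourier
integrals of its truncations from below. -/
theorem exists_tendsto_fourier_truncation {p : ℝ≥0∞} (hp : 1 ≤ p) (hp2 : p < 2) {f : R3 → ℂ}
    (hfm : Measurable f) (hf : MemLp f p volume) :
    ∃ a : ℕ → ℝ≥0∞, (∀ n, a n ≠ 0 ∧ a n ≠ ∞) ∧
      ∀ᵐ ξ, Tendsto (fun n => 𝓕 ({x | a n < ‖f x‖ₑ}.indicator f) ξ) atTop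
        (nhds (fourierL1L2 f ξ)) := by
  have hp' : p ≠ ∞ := hp2.ne_top
  set a : ℕ → ℝ≥0∞ := fun n => ((n : ℝ≥0∞) + 1)⁻¹ with ha
  have ha0 : ∀ n, a n ≠ 0 := fun n => by simp [ha]
  have hatop : ∀ n, a n ≠ ∞ := fun n => by simp [ha]
  have ha1 : ∀ n, a n ≤ 1 := fun n => ENNReal.inv_le_one.2 (by simp)
  have halim : Tendsto a atTop (nhds 0) := by
    have := (tendsto_add_atTop_iff_nat 1).2 ENNReal.tendsto_inv_nat_nhds_zero
    simpa [ha] using this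
  have hS : MemLp (smallPart f) 2 volume := memLp_smallPart hp hp2.le hf
  have hL : Integrable (largePart f) := memLp_one_iff_integrable.1 (memLp_largePart hp hp2.le hf)
  have hSm : Measurable (smallPart f) := hfm.indicator (measurableSet_enorm_le hfm 1)
  set s : ℕ → R3 → ℂ := fun n => {x | a n < ‖f x‖ₑ}.indicator (smallPart f) with hs
  have hs2 : ∀ n, MemLp (s n) 2 volume := fun n => hS.indicator (measurableSet_lt_enorm hfm _)
  have hs1 : ∀ n, Integrable (s n) := fun n => by
    refine integrable_of_large hp hp' hf (hSm.indicator (measurableSet_lt_enorm hfm _))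
      (ha0 n) (hatop n) fun x => ?_
    by_cases h1 : a n < ‖f x‖ₑ
    · by_cases h2 : ‖f x‖ₑ ≤ 1
      · exact Or.inr ⟨by simp [hs, smallPart, h1, h2], h1.le⟩
      · exact Or.inl (by simp [hs, smallPart, h2])
    · exact Or.inl (by simp [hs, h1])
  have hsum : ∀ n ξ, 𝓕 ({x | a n < ‖f x‖ₑ}.indicator f) ξ = 𝓕 (largePart f) ξ + 𝓕 (s n) ξ := by
    intro n ξ
    rw [← fourier_integral_add hL (hs1 n)]
    refine congrArg (fun u : R3 → ℂ => 𝓕 u ξ) (funext fun x => ?_)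
    by_cases h1 : ‖f x‖ₑ ≤ 1
    · by_cases h2 : a n < ‖f x‖ₑ
      · simp [hs, largePart, smallPart, h1, h2, not_lt.2 h1]
      · simp [hs, largePart, h2, not_lt.2 h1]
    · have h2 : a n < ‖f x‖ₑ := (ha1 n).trans_lt (not_le.1 h1)
      simp [hs, largePart, smallPart, h1, h2, not_le.1 h1]
  have hlim : Tendsto (fun n => (hs2 n).toLp (s n)) atTop (nhds (hS.toLp (smallPart f))) := by
    rw [Lp.tendsto_Lp_iff_tendsto_eLpNorm'' s hs2]
    have hd := tendsto_eLpNorm_two_of_small hp hp2 hf halim hatop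
      (d := fun n => smallPart f - s n) fun n x => ?_
    · refine hd.congr fun n => ?_
      exact eLpNorm_sub_comm _ _ _ _
    by_cases h1 : a n < ‖f x‖ₑ
    · exact Or.inl (by simp [hs, h1])
    · have h2 : ‖f x‖ₑ ≤ 1 := (not_lt.1 h1).trans (ha1 n)
      exact Or.inr ⟨by simp [hs, smallPart, h1, h2], not_lt.1 h1⟩
  have hF : Tendsto (fun n => (𝓕 ((hs2 n).toLp (s n)) : Lp ℂ 2 (volume : Measure R3))) atTop
      (nhds (𝓕 (hS.toLp (smallPart f)))) :=
    ((Lp.fourierTransformₗᵢ R3 ℂ).continuous.tendsto _).comp hlim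
  -- Convergence in `L²` gives almost everywhere convergence only along a subsequence, so the
  -- heights are taken along `φ`.
  obtain ⟨φ, -, hφ⟩ := (tendstoInMeasure_of_tendsto_Lp hF).exists_seq_tendsto_ae
  refine ⟨fun n => a (φ n), fun n => ⟨ha0 _, hatop _⟩, ?_⟩
  have hae : ∀ᵐ ξ, ∀ n, (𝓕 ((hs2 n).toLp (s n)) : Lp ℂ 2 (volume : Measure R3)) ξ = 𝓕 (s n) ξ :=
    ae_all_iff.2 fun n => fourier_toLp_ae_eq (hs1 n) (hs2 n)
  filter_upwards [hφ, hae] with ξ h1 h2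
  simp only [hsum, fourierL1L2, dif_pos hS]
  simp only [h2] at h1
  exact h1.const_add _

/-- The equality holds everywhere: both summands depend only on almost everywhere classes. Hence `f`
may be replaced by a measurable representative. -/
theorem fourierL1L2_congr_ae {f g : R3 → ℂ} (h : f =ᵐ[volume] g) :
    fourierL1L2 f = fourierL1L2 g := by
  have hS : smallPart f =ᵐ[volume] smallPart g := by
    filter_upwards [h] with x hx
    simp [smallPart, indicator, hx]
  have hL : largePart f =ᵐ[volume] largePart g := by
    filter_upwards [h] with x hx
    simp [largePart, indicator, hx]
  by_cases hf : MemLp (smallPart f) 2 volume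
  · have hg : MemLp (smallPart g) 2 volume := hf.ae_eq hS
    funext ξ
    rw [fourierL1L2, fourierL1L2, dif_pos hf, dif_pos hg, MemLp.toLp_congr hf hg hS,
      Real.fourier_congr_ae hL]
  · have hg : ¬ MemLp (smallPart g) 2 volume := fun hg => hf (hg.ae_eq hS.symm)
    rw [fourierL1L2, fourierL1L2, dif_neg hf, dif_neg hg]

/-- A bound for functions which are bounded below where they do not vanish extends to `L^p`. -/
theorem sphereNorm_fourierL1L2_le {r : ℝ} (hr : 0 < r) {p : ℝ≥0∞} (hp : 1 ≤ p) (hp2 : p < 2)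
    {C : ℝ≥0∞} (hC : ∀ f : R3 → ℂ, Measurable f → Integrable f → MemLp f p volume →
      (∃ η : ℝ≥0∞, η ≠ 0 ∧ ∀ x, f x = 0 ∨ η ≤ ‖f x‖ₑ) →
      sphereNorm r (𝓕 f) ≤ C * eLpNorm f p volume) {f : R3 → ℂ} (hf : MemLp f p volume) :
    sphereNorm r (fourierL1L2 f) ≤ C * eLpNorm f p volume := by
  obtain ⟨g, hg, hae⟩ := hf.1
  have hfm : Measurable g := hg.measurable
  have hf' : MemLp g p volume := hf.ae_eq hae
  rw [fourierL1L2_congr_ae hae, eLpNorm_congr_ae hae]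
  obtain ⟨a, ha, hlim⟩ := exists_tendsto_fourier_truncation hp hp2 hfm hf'
  have hms : ∀ n, MeasurableSet {x | a n < ‖g x‖ₑ} := fun n => measurableSet_lt_enorm hfm _
  have hlarge : ∀ n x, {x | a n < ‖g x‖ₑ}.indicator g x = 0 ∨
      {x | a n < ‖g x‖ₑ}.indicator g x = g x ∧ a n ≤ ‖g x‖ₑ := by
    intro n x
    by_cases h : a n < ‖g x‖ₑ
    · exact Or.inr ⟨by simp [h], h.le⟩
    · exact Or.inl (by simp [h])
  have hint : ∀ n, Integrable ({x | a n < ‖g x‖ₑ}.indicator g) := fun n =>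
    integrable_of_large hp hp2.ne_top hf' (hfm.indicator (hms n)) (ha n).1 (ha n).2 (hlarge n)
  refine sphereNorm_le_of_tendsto_ae hr (fun n => (continuous_fourier (hint n)).measurable) hlim
    fun n => ?_
  refine (hC _ (hfm.indicator (hms n)) (hint n) (hf'.indicator (hms n))
    ⟨a n, (ha n).1, fun x => ?_⟩).trans ?_
  · exact (hlarge n x).imp id fun h => by rw [h.1]; exact h.2
  · gcongr
    exact eLpNorm_indicator_le g

end

theorem theorem4 :
    (∀ (r : ℝ) (p : ℝ≥0∞), 1 ≤ r → r < 2 → 1 ≤ p → p ≤ 4 / 3 →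
      ∃ C : ℝ≥0, ∀ f : R3 → ℂ, MemLp f p volume →
        eLpNorm (fun ω : S2 => rMaximal r (fourierL1L2 f) (ω : R3)) 2 surfaceMeasure
          ≤ C * eLpNorm f p volume) ∧
    (∀ p : ℝ≥0∞, 1 ≤ p → p < 4 / 3 →
      ∃ C : ℝ≥0, ∀ f : R3 → ℂ, MemLp f p volume →
        eLpNorm (fun ω : S2 => rMaximal 2 (fourierL1L2 f) (ω : R3)) 2 surfaceMeasure
          ≤ C * eLpNorm f p volume) := by
  have h2 : (4 / 3 : ℝ≥0∞) < 2 := by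
    rw [← ENNReal.toReal_lt_toReal (ENNReal.div_ne_top (by simp) (by simp)) (by simp)]
    norm_num
  refine ⟨fun r p hr hr2 hp hp4 => ?_, fun p hp hp4 => ?_⟩
  · obtain ⟨C, hC, h⟩ := exists_sphereNorm_fourier_le hr hr2 hp hp4
    refine ⟨C.toNNReal, fun f hf => ?_⟩
    rw [ENNReal.coe_toNNReal hC]
    exact sphereNorm_fourierL1L2_le (by linarith) hp (hp4.trans_lt h2)
      (fun f hfm hfi hf _ => h f hfm hfi hf) hf
  · obtain ⟨C, hC, h⟩ := exists_sphereNorm_two_fourier_le_of_lt hp hp4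
    refine ⟨C.toNNReal, fun f hf => ?_⟩
    rw [ENNReal.coe_toNNReal hC]
    exact sphereNorm_fourierL1L2_le two_pos hp (hp4.trans h2) h hf
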